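/- Fix $t\in(0,1)$. For $d\ge 1$ and positive definite $A_1,A_2\in\mathcal B(\mathbb C^d)$ let $A_2\#_tA_1:=A_2^{1/2}\big(A_2^{-1/2}A_1A_2^{-1/2}\big)^tA_2^{1/2}$ be the $t$-weighted Kubo–Ando geometric mean, and, for $z\in(0,\infty)$, let $$G_{t,z}(A_1,A_2):=\Big(A_1^{\frac{t}{2z}}A_2^{\frac{1-t}{z}}A_1^{\frac{t}{2z}}\Big)^z,\qquad \widetilde G_{t,z}(A_1,A_2):=\Big(A_2^{\frac{1-t}{2z}}A_1^{\frac{t}{z}}A_2^{\frac{1-t}{2z}}\Big)^z,$$ $$\widehat G_{t,z}(A_1,A_2):=\Big(A_2^{\frac1z}\#_tA_1^{\frac1z}\Big)^z,\qquad \widehat G_{t,\infty}(A_1,A_2):=e^{t\log A_1+(1-t)\log A_2}.$$ Each of these is regarded as a $2$-variable positive operator function whose domain consists of all pairs of positive definite operators on $\mathbb C^d$, $d\ge1$. A $2$-variable positive operator function $G$ is called asymptotically individually AM bounded if for every $A=(A_1,A_2)$ in its domain there are positive measures $\mu_n$ on $\{1,2\}$, $n\ge 1$ (which may depend on $A$),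 such that, in the Löwner order, $$G(A_1,A_2)^{\otimes n}\le\int_{\{1,2\}}A_y^{\otimes n}\,d\mu_n(y)\quad(n\ge1)\qquad\text{and}\qquad\limsup_{n\to\infty}\frac1n\log\mu_n(\{1,2\})\le0.$$ (a) None of the following is asymptotically individually AM bounded: $G_{t,z}$ for any $z\in(0,\infty)$; $\widetilde G_{t,z}$ for any $z\in(0,\infty)$; $\widehat G_{t,z}$ for any $z\in(0,1)\cup(1,\infty]$. (b) Let $G'_t$ be any of $G_{t,z}$ with $z\in(0,\infty)$, $\widetilde G_{t,z}$ with $z\in(0,\infty)$, or $\widehat G_{t,z}$ with $z\in(1,\infty]$. Then there are positive definite operators $A_1,A_2\in\mathcal B(\mathbb C^2)$ such that $G'_t(A_1,A_2)\nleq A_2\#_tA_1$. -/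

import Mathlib

open Filter MeasureTheory
open scoped Matrix ComplexOrder MatrixOrder ENNReal

namespace OperatorMeans

/-- Operators on the Hilbert space `ℂ^d`, as matrices. The order `≤` on them is the Löwner order
(`A ≤ B` means that `B - A` is positive semi-definite). -/
abbrev Op (d : ℕ) := Matrix (Fin d) (Fin d) ℂ

/-- Matrix-valued integral `∫ F dμ`, taken entry by entry. -/
noncomputable def matIntegral {Y : Type*} [MeasurableSpace Y] {m : Type*} (μ : Measure Y)
    (F : Y → Matrix m m ℂ) : Matrix m m ℂ :=
  Matrix.of fun i j => ∫ y, F y i j ∂μ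

/-- The tensor power `A^{⊗n}`, in the product basis of `(ℂ^d)^{⊗n}`, which is indexed by
`Fin n → Fin d`. -/
def tensorPow {d : ℕ} (A : Op d) (n : ℕ) : Matrix (Fin n → Fin d) (Fin n → Fin d) ℂ :=
  Matrix.of fun i j => ∏ k, A (i k) (j k)

/-- A `Y`-variable positive operator function: it assigns a positive semi-definite operator on
`ℂ^d` to each family in its (non-empty) domain, which consists of measurable families of positive
semi-definite operators on `ℂ^d`, `d ≥ 1`, and it is covariant under unitaries.
Values of `toFun` outside the domain carry no meaning. -/
structure PosOpFun (Y : Type*) [MeasurableSpace Y] where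
  dom : ∀ d : ℕ, Set (Y → Op d)
  toFun : ∀ d : ℕ, (Y → Op d) → Op d
  dom_nonempty : ∃ d A, A ∈ dom d
  dom_pos : ∀ d, ∀ A ∈ dom d, 0 < d
  dom_measurable : ∀ d, ∀ A ∈ dom d, ∀ i j, Measurable fun y => A y i j
  dom_posSemidef : ∀ d, ∀ A ∈ dom d, ∀ y, (A y).PosSemidef
  posSemidef : ∀ d, ∀ A ∈ dom d, (toFun d A).PosSemidef
  dom_unitary : ∀ d, ∀ A ∈ dom d, ∀ V ∈ Matrix.unitaryGroup (Fin d) ℂ,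
    (fun y => V * A y * Vᴴ) ∈ dom d
  map_unitary : ∀ d, ∀ A ∈ dom d, ∀ V ∈ Matrix.unitaryGroup (Fin d) ℂ,
    toFun d (fun y => V * A y * Vᴴ) = V * toFun d A * Vᴴ

/-- Asymptotic individual arithmetic mean boundedness: for every `A` in the domain there are
positive measures `μ n` (which may depend on `A`), `n ≥ 1`, with
`G(A)^{⊗n} ≤ ∫ A_y^{⊗n} dμ_n(y)` and `limsup_n (1/n) log μ_n(Y) ≤ 0`. -/
def PosOpFun.AsympIndivAMBounded {Y : Type*} [MeasurableSpace Y] (G : PosOpFun Y) : Prop :=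
  ∀ d, ∀ A ∈ G.dom d, ∃ μ : ℕ → Measure Y,
    (∀ n, 1 ≤ n →
      (∀ i j, Integrable (fun y => tensorPow (A y) n i j) (μ n)) ∧
      tensorPow (G.toFun d A) n ≤ matIntegral (μ n) fun y => tensorPow (A y) n) ∧
    limsup (fun n : ℕ => ENNReal.log (μ n Set.univ) / (n : EReal)) atTop ≤ 0

/-- The real power `A^p` by functional calculus. -/
noncomputable def mpow {d : ℕ} (A : Op d) (p : ℝ) : Op d := cfc (fun x : ℝ => x ^ p) A

/-- The logarithm by functional calculus. -/
noncomputable def mlog {d : ℕ} (A : Op d) : Op d := cfc Real.log A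

/-- The exponential of a Hermitian matrix by functional calculus. -/
noncomputable def mexp {d : ℕ} (A : Op d) : Op d := cfc Real.exp A

/-- The `t`-weighted Kubo-Ando geometric mean `A₂ #_t A₁` of positive definite operators. -/
noncomputable def kuboAndo {d : ℕ} (t : ℝ) (A₂ A₁ : Op d) : Op d :=
  mpow A₂ (1 / 2) * mpow (mpow A₂ (-(1 / 2)) * A₁ * mpow A₂ (-(1 / 2))) t * mpow A₂ (1 / 2)

/-- `(A₁^{t/2z} A₂^{(1-t)/z} A₁^{t/2z})^z` -/
noncomputable def meanGFun {d : ℕ} (t z : ℝ) (A₁ A₂ : Op d) : Op d :=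
  mpow (mpow A₁ (t / (2 * z)) * mpow A₂ ((1 - t) / z) * mpow A₁ (t / (2 * z))) z

/-- `(A₂^{(1-t)/2z} A₁^{t/z} A₂^{(1-t)/2z})^z` -/
noncomputable def meanGTildeFun {d : ℕ} (t z : ℝ) (A₁ A₂ : Op d) : Op d :=
  mpow (mpow A₂ ((1 - t) / (2 * z)) * mpow A₁ (t / z) * mpow A₂ ((1 - t) / (2 * z))) z

/-- `(A₂^{1/z} #_t A₁^{1/z})^z` -/
noncomputable def meanGHatFun {d : ℕ} (t z : ℝ) (A₁ A₂ : Op d) : Op d :=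
  mpow (kuboAndo t (mpow A₂ (1 / z)) (mpow A₁ (1 / z))) z

/-- `exp (t log A₁ + (1-t) log A₂)`, the log-Euclidean geometric mean (the case `z = ∞`). -/
noncomputable def meanGHatTopFun {d : ℕ} (t : ℝ) (A₁ A₂ : Op d) : Op d :=
  mexp (t • mlog A₁ + (1 - t) • mlog A₂)

section Helpers

variable {d : ℕ}

theorem cfc_unitary_conj (f : ℝ → ℝ) (A : Op d) (hA : A.IsHermitian) {V : Op d}
    (hV : V ∈ Matrix.unitaryGroup (Fin d) ℂ) :
    cfc f (V * A * Vᴴ) = V * cfc f A * Vᴴ := by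
  have hA' : IsSelfAdjoint A := hA
  have h := StarAlgHomClass.map_cfc (S := ℂ) (Unitary.conjStarAlgAut ℂ (Op d) ⟨V, hV⟩) f A
    (Matrix.finite_real_spectrum.continuousOn _)
    (by
      have : Continuous fun x : Op d => V * x * Vᴴ := by fun_prop
      exact this) hA' (hA'.map _)
  exact h.symm

theorem mpow_posSemidef {A : Op d} (hA : A.PosSemidef) (p : ℝ) : (mpow A p).PosSemidef := by
  rw [← Matrix.nonneg_iff_posSemidef] at hA ⊢
  exact cfc_nonneg fun x hx => Real.rpow_nonneg (spectrum_nonneg_of_nonneg hA hx) p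

theorem sandwich_posSemidef {X B : Op d} (hX : X.PosSemidef) (hB : B.PosSemidef) :
    (X * B * X).PosSemidef := by
  have h := hB.mul_mul_conjTranspose_same X
  rwa [hX.isHermitian.eq] at h

theorem conj_mul_conj {V : Op d} (hV : V ∈ Matrix.unitaryGroup (Fin d) ℂ) (X Y : Op d) :
    (V * X * Vᴴ) * (V * Y * Vᴴ) = V * (X * Y) * Vᴴ := by
  have h : Vᴴ * V = 1 := Matrix.mem_unitaryGroup_iff'.1 hV
  calc (V * X * Vᴴ) * (V * Y * Vᴴ) = V * X * (Vᴴ * V) * Y * Vᴴ := by simp only [mul_assoc]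
    _ = V * (X * Y) * Vᴴ := by rw [h]; simp only [mul_assoc, one_mul]

theorem mpow_conj {A : Op d} (hA : A.PosSemidef) {V : Op d}
    (hV : V ∈ Matrix.unitaryGroup (Fin d) ℂ) (p : ℝ) :
    mpow (V * A * Vᴴ) p = V * mpow A p * Vᴴ :=
  cfc_unitary_conj _ A hA.isHermitian hV

theorem kuboAndo_posSemidef (t : ℝ) {A₂ A₁ : Op d} (h₂ : A₂.PosSemidef) (h₁ : A₁.PosSemidef) :
    (kuboAndo t A₂ A₁).PosSemidef :=
  sandwich_posSemidef (mpow_posSemidef h₂ _)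
    (mpow_posSemidef (sandwich_posSemidef (mpow_posSemidef h₂ _) h₁) _)

theorem kuboAndo_conj (t : ℝ) {A₂ A₁ : Op d} (h₂ : A₂.PosSemidef) (h₁ : A₁.PosSemidef)
    {V : Op d} (hV : V ∈ Matrix.unitaryGroup (Fin d) ℂ) :
    kuboAndo t (V * A₂ * Vᴴ) (V * A₁ * Vᴴ) = V * kuboAndo t A₂ A₁ * Vᴴ := by
  simp only [kuboAndo, mpow_conj h₂ hV, conj_mul_conj hV,
    mpow_conj (sandwich_posSemidef (mpow_posSemidef h₂ _) h₁) hV]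

end Helpers

/-- The positive operator function of two variables `(A₁, A₂) = (A 0, A 1)` given by a formula `F`
on the domain of all pairs of positive definite operators on `ℂ^d`, `d ≥ 1`. -/
def ofFormula (F : ∀ d : ℕ, Op d → Op d → Op d)
    (hpos : ∀ d (A₁ A₂ : Op d), A₁.PosDef → A₂.PosDef → (F d A₁ A₂).PosSemidef)
    (hconj : ∀ d (A₁ A₂ : Op d), A₁.PosDef → A₂.PosDef → ∀ V ∈ Matrix.unitaryGroup (Fin d) ℂ,
      F d (V * A₁ * Vᴴ) (V * A₂ * Vᴴ) = V * F d A₁ A₂ * Vᴴ) :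
    PosOpFun (Fin 2) where
  dom d := {A | 0 < d ∧ ∀ y, (A y).PosDef}
  toFun d A := F d (A 0) (A 1)
  dom_nonempty := ⟨1, fun _ => 1, one_pos, fun _ => Matrix.PosDef.one⟩
  dom_pos _ _ hA := hA.1
  dom_measurable _ _ _ _ _ := Measurable.of_discrete
  dom_posSemidef _ _ hA y := (hA.2 y).posSemidef
  posSemidef d A hA := hpos d _ _ (hA.2 0) (hA.2 1)
  dom_unitary d A hA V hV := by
    refine ⟨hA.1, fun y => (hA.2 y).mul_mul_conjTranspose_same ?_⟩
    have h : V * Vᴴ = 1 := Matrix.mem_unitaryGroup_iff.1 hV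
    intro x y hxy
    have hx := congrArg (fun w => Matrix.vecMul w Vᴴ) hxy
    simpa [Matrix.vecMul_vecMul, h] using hx
  map_unitary d A hA V hV := hconj d _ _ (hA.2 0) (hA.2 1) V hV

/-- The mean `G_{t,z}`. -/
noncomputable def meanG (t z : ℝ) : PosOpFun (Fin 2) :=
  ofFormula (fun _ A₁ A₂ => meanGFun t z A₁ A₂)
    (fun _ _ _ h₁ h₂ => mpow_posSemidef (sandwich_posSemidef (mpow_posSemidef h₁.posSemidef _)
      (mpow_posSemidef h₂.posSemidef _)) _)
    (fun _ _ _ h₁ h₂ V hV => by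
      simp only [meanGFun, mpow_conj h₁.posSemidef hV, mpow_conj h₂.posSemidef hV,
        conj_mul_conj hV, mpow_conj (sandwich_posSemidef (mpow_posSemidef h₁.posSemidef _)
          (mpow_posSemidef h₂.posSemidef _)) hV])

/-- The mean `G̃_{t,z}`. -/
noncomputable def meanGTilde (t z : ℝ) : PosOpFun (Fin 2) :=
  ofFormula (fun _ A₁ A₂ => meanGTildeFun t z A₁ A₂)
    (fun _ _ _ h₁ h₂ => mpow_posSemidef (sandwich_posSemidef (mpow_posSemidef h₂.posSemidef _)
      (mpow_posSemidef h₁.posSemidef _)) _)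
    (fun _ _ _ h₁ h₂ V hV => by
      simp only [meanGTildeFun, mpow_conj h₁.posSemidef hV, mpow_conj h₂.posSemidef hV,
        conj_mul_conj hV, mpow_conj (sandwich_posSemidef (mpow_posSemidef h₂.posSemidef _)
          (mpow_posSemidef h₁.posSemidef _)) hV])

/-- The mean `Ĝ_{t,z}`, `z` finite. -/
noncomputable def meanGHat (t z : ℝ) : PosOpFun (Fin 2) :=
  ofFormula (fun _ A₁ A₂ => meanGHatFun t z A₁ A₂)
    (fun _ _ _ h₁ h₂ => mpow_posSemidef (kuboAndo_posSemidef t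
      (mpow_posSemidef h₂.posSemidef _) (mpow_posSemidef h₁.posSemidef _)) _)
    (fun _ _ _ h₁ h₂ V hV => by
      simp only [meanGHatFun, mpow_conj h₁.posSemidef hV, mpow_conj h₂.posSemidef hV,
        kuboAndo_conj t (mpow_posSemidef h₂.posSemidef _) (mpow_posSemidef h₁.posSemidef _) hV,
        mpow_conj (kuboAndo_posSemidef t (mpow_posSemidef h₂.posSemidef _)
          (mpow_posSemidef h₁.posSemidef _)) hV])

/-- The mean `Ĝ_{t,∞}`. -/
noncomputable def meanGHatTop (t : ℝ) : PosOpFun (Fin 2) :=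
  ofFormula (fun _ A₁ A₂ => meanGHatTopFun t A₁ A₂)
    (fun _ _ _ _ _ => by
      rw [← Matrix.nonneg_iff_posSemidef]
      exact cfc_nonneg fun x _ => (Real.exp_pos x).le)
    (fun _ A₁ A₂ h₁ h₂ V hV => by
      have hs : (t • mlog A₁ + (1 - t) • mlog A₂).IsHermitian := by
        have e₁ : IsSelfAdjoint (mlog A₁) := cfc_predicate _ _
        have e₂ : IsSelfAdjoint (mlog A₂) := cfc_predicate _ _
        exact ((IsSelfAdjoint.all t).smul e₁).add ((IsSelfAdjoint.all (1 - t)).smul e₂)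
      simp only [meanGHatTopFun, mexp]
      rw [← cfc_unitary_conj _ _ hs hV]
      simp only [mlog, cfc_unitary_conj _ _ h₁.isHermitian hV,
        cfc_unitary_conj _ _ h₂.isHermitian hV, mul_add, add_mul, mul_smul_comm, smul_mul_assoc])

end OperatorMeans

/-!
An asymptotically individually AM bounded mean with the right homogeneity lies below `A₂ #ₜ A₁`,
and the means here do not.

Upper bound: every mean `G` here satisfies `G(c A₁, A₂) = c ^ t G(A₁, A₂)`. After a congruence
making `A₂ = 1` and `A₁` diagonal with entries `bᵢ`, the hypothesis bounds `G(A₁, A₂)^{⊗n}`, for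
each `c > 0` and up to subexponential factors, by the diagonal matrix whose entries are
`(c ^ n ∏ bᵢ + 1) / c ^ (t n)`, the product being over `n` indices. If these `bᵢ` have geometric
mean `exp y`, the best choice is `c = exp (-y)`, which gives `exp (t n y)`, the corresponding entry
of `(A₂ #ₜ A₁)^{⊗n}`. As `y` ranges over a compact interval, finitely many `c` are nearly optimal
for all entries and all `n` at once, and pinching onto the groups of entries sharing a `c` costs
only a factor equal to the number of groups. Taking `n`-th roots of diagonal entries gives
`G(A₁, A₂) ≤ A₂ #ₜ A₁`.

Obstruction: all the means have determinant `det A₁ ^ t * det A₂ ^ (1 - t)`, so this inequality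
forces equality, and then `A₂ #ₜ A₁` commutes with the operator of which `G(A₁, A₂)` is a function.
For `A₁ = exp (a S)` and `A₂ = exp (b T)`, where `S` and `T` anticommute and `S² = T² = 1`, both
operators lie in the real span of `1`, `S`, `T`, so their `S`- and `T`-coordinates are
proportional. As `a → ∞` the ratio of these coordinates grows like `exp (2 t a)` for `A₂ #ₜ A₁`,
while it is bounded for `G̃_{t,z}`, linear for `Ĝ_{t,∞}`, and of order `exp (2 t a / z)` for
`Ĝ_{t,z}`. The mean `G_{t,z}` is `G̃_{1-t,z}` with the arguments exchanged.
-/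

namespace OperatorMeans

section FunctionalCalculus

variable {d : ℕ} {A B : Op d}

theorem pos_of_mem_spectrum (hA : A.PosDef) {x : ℝ} (hx : x ∈ spectrum ℝ A) : 0 < x :=
  (Matrix.isStrictlyPositive_iff_posDef.2 hA).spectrum_pos hx

theorem cfc_posDef (hA : A.IsHermitian) {f : ℝ → ℝ} (hf : ∀ x ∈ spectrum ℝ A, 0 < f x) :
    (cfc f A).PosDef :=
  Matrix.isStrictlyPositive_iff_posDef.1 <|
    (cfc_isStrictlyPositive_iff f A (A.finite_real_spectrum.continuousOn _) hA).2 hf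

theorem cfc_cfc (hA : A.IsHermitian) (f g : ℝ → ℝ) : cfc g (cfc f A) = cfc (fun x => g (f x)) A :=
  (cfc_comp' g f A ((A.finite_real_spectrum.image _).continuousOn _)
    (A.finite_real_spectrum.continuousOn _) hA).symm

theorem smul_cfc (r : ℝ) (f : ℝ → ℝ) (A : Op d) : r • cfc f A = cfc (fun x => r * f x) A :=
  (cfc_const_mul r f A (A.finite_real_spectrum.continuousOn _)).symm

theorem mexp_posDef (hA : A.IsHermitian) : (mexp A).PosDef :=
  cfc_posDef hA fun _ _ => Real.exp_pos _

theorem mlog_isHermitian (A : Op d) : (mlog A).IsHermitian :=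
  cfc_predicate (p := IsSelfAdjoint) _ _

theorem mlog_mexp (hA : A.IsHermitian) : mlog (mexp A) = A := by
  simp only [mlog, mexp, cfc_cfc hA, Real.log_exp]
  exact cfc_id' ℝ A hA.isSelfAdjoint

theorem mexp_mlog (hA : A.PosDef) : mexp (mlog A) = A := by
  rw [mexp, mlog, cfc_cfc hA.isHermitian]
  exact (cfc_congr fun x hx => Real.exp_log (pos_of_mem_spectrum hA hx)).trans
    (cfc_id' ℝ A hA.isHermitian.isSelfAdjoint)

theorem mpow_mexp (hA : A.IsHermitian) (p : ℝ) : mpow (mexp A) p = mexp (p • A) := by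
  nth_rewrite 2 [← cfc_id' ℝ A hA.isSelfAdjoint]
  rw [mpow, mexp, cfc_cfc hA, mexp, smul_cfc, cfc_cfc hA]
  exact cfc_congr fun x _ => by rw [← Real.exp_mul, mul_comm]

theorem mpow_eq_mexp (hA : A.PosDef) (p : ℝ) : mpow A p = mexp (p • mlog A) := by
  rw [← mpow_mexp (mlog_isHermitian A), mexp_mlog hA]

theorem mpow_posDef (hA : A.PosDef) (p : ℝ) : (mpow A p).PosDef :=
  cfc_posDef hA.isHermitian fun _ hx => Real.rpow_pos_of_pos (pos_of_mem_spectrum hA hx) p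

theorem mpow_mul_mpow (hA : A.PosDef) (p q : ℝ) : mpow A p * mpow A q = mpow A (p + q) := by
  rw [mpow, mpow, mpow, ← cfc_mul _ _ A (A.finite_real_spectrum.continuousOn _)
    (A.finite_real_spectrum.continuousOn _)]
  exact cfc_congr fun x hx => (Real.rpow_add (pos_of_mem_spectrum hA hx) p q).symm

theorem mpow_mul_mpow_neg (hA : A.PosDef) (p : ℝ) : mpow A p * mpow A (-p) = 1 := by
  rw [mpow_mul_mpow hA, add_neg_cancel]
  simpa only [mpow, Real.rpow_zero] using cfc_const_one ℝ A hA.isHermitian.isSelfAdjoint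

theorem mpow_neg_mul_mpow (hA : A.PosDef) (p : ℝ) : mpow A (-p) * mpow A p = 1 := by
  simpa only [neg_neg] using mpow_mul_mpow_neg hA (-p)

theorem mpow_one (hA : A.IsHermitian) : mpow A 1 = A := by
  simpa only [mpow, Real.rpow_one] using cfc_id' ℝ A hA.isSelfAdjoint

theorem mpow_smul (hA : A.PosDef) {c : ℝ} (hc : 0 < c) (p : ℝ) :
    mpow (c • A) p = c ^ p • mpow A p := by
  nth_rewrite 1 [← cfc_id' ℝ A hA.isHermitian.isSelfAdjoint]
  rw [mpow, smul_cfc, cfc_cfc hA.isHermitian, mpow, smul_cfc]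
  exact cfc_congr fun x hx => Real.mul_rpow hc.le (pos_of_mem_spectrum hA hx).le

theorem mexp_smul_one_add (hA : A.IsHermitian) (c : ℝ) :
    mexp (c • 1 + A) = Real.exp c • mexp A := by
  have hshift : c • (1 : Op d) + A = cfc (fun x : ℝ => c + x) A := by
    rw [cfc_const_add c _ A, cfc_id' ℝ A hA.isSelfAdjoint, Algebra.algebraMap_eq_smul_one]
  rw [hshift, mexp, cfc_cfc hA, mexp, smul_cfc]
  simp only [Real.exp_add]

theorem mlog_smul (hA : A.PosDef) {c : ℝ} (hc : 0 < c) :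
    mlog (c • A) = Real.log c • 1 + mlog A := by
  have hH := mlog_isHermitian A
  have hshift : (Real.log c • 1 + mlog A).IsHermitian :=
    (Matrix.isHermitian_one.smul (.all _)).add hH
  rw [← mlog_mexp hshift, mexp_smul_one_add hH, mexp_mlog hA, Real.exp_log hc]

theorem sandwich_posDef (hA : A.PosDef) (hB : B.PosDef) : (A * B * A).PosDef := by
  have h := (Matrix.IsUnit.posDef_star_left_conjugate_iff hA.isUnit (x := B)).2 hB
  rwa [Matrix.star_eq_conjTranspose, hA.isHermitian.eq] at h

theorem kuboAndo_posDef (t : ℝ) (hB : B.PosDef) (hA : A.PosDef) : (kuboAndo t B A).PosDef :=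
  sandwich_posDef (mpow_posDef hB _) (mpow_posDef (sandwich_posDef (mpow_posDef hB _) hA) _)

theorem sandwich_mpow_neg_half (hA : A.PosDef) :
    mpow A (-(1 / 2)) * A * mpow A (-(1 / 2)) = 1 := by
  have hsplit : A = mpow A (1 / 2) * mpow A (1 / 2) := by
    rw [mpow_mul_mpow hA, add_halves, mpow_one hA.isHermitian]
  nth_rewrite 2 [hsplit]
  rw [← mul_assoc, mpow_neg_mul_mpow hA, one_mul, mpow_mul_mpow_neg hA]

theorem sandwich_kuboAndo (t : ℝ) (A : Op d) (hB : B.PosDef) :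
    mpow B (-(1 / 2)) * kuboAndo t B A * mpow B (-(1 / 2)) =
      mpow (mpow B (-(1 / 2)) * A * mpow B (-(1 / 2))) t := by
  set T := mpow B (-(1 / 2)) with hT
  calc T * kuboAndo t B A * T
      = (T * mpow B (1 / 2)) * mpow (T * A * T) t * (mpow B (1 / 2) * T) := by
        simp only [kuboAndo, mul_assoc, hT]
    _ = mpow (T * A * T) t := by
        rw [mpow_neg_mul_mpow hB, mpow_mul_mpow_neg hB, one_mul, mul_one]

end FunctionalCalculus

section Homogeneity

variable {d : ℕ} {t z c : ℝ} {A₁ A₂ : Op d}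

theorem kuboAndo_smul (h₁ : A₁.PosDef) (h₂ : A₂.PosDef) (hc : 0 < c) :
    kuboAndo t A₂ (c • A₁) = c ^ t • kuboAndo t A₂ A₁ := by
  simp only [kuboAndo, mul_smul_comm, smul_mul_assoc,
    mpow_smul (sandwich_posDef (mpow_posDef h₂ (-(1 / 2))) h₁) hc]

theorem meanGFun_smul (h₁ : A₁.PosDef) (h₂ : A₂.PosDef) (hz : z ≠ 0) (hc : 0 < c) :
    meanGFun t z (c • A₁) A₂ = c ^ t • meanGFun t z A₁ A₂ := by
  have hexp : t / (2 * z) * z + t / (2 * z) * z = t := by field_simp; ring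
  have hpos := Real.rpow_pos_of_pos hc (t / (2 * z))
  simp only [meanGFun, mpow_smul h₁ hc, smul_mul_assoc, mul_smul_comm, smul_smul,
    mpow_smul (sandwich_posDef (mpow_posDef h₁ (t / (2 * z))) (mpow_posDef h₂ ((1 - t) / z)))
      (mul_pos hpos hpos)]
  rw [Real.mul_rpow hpos.le hpos.le, ← Real.rpow_mul hc.le, ← Real.rpow_add hc, hexp]

theorem meanGTildeFun_smul (h₁ : A₁.PosDef) (h₂ : A₂.PosDef) (hz : z ≠ 0) (hc : 0 < c) :
    meanGTildeFun t z (c • A₁) A₂ = c ^ t • meanGTildeFun t z A₁ A₂ := by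
  simp only [meanGTildeFun, mpow_smul h₁ hc, smul_mul_assoc, mul_smul_comm,
    mpow_smul (sandwich_posDef (mpow_posDef h₂ ((1 - t) / (2 * z))) (mpow_posDef h₁ (t / z)))
      (Real.rpow_pos_of_pos hc _)]
  rw [← Real.rpow_mul hc.le, div_mul_cancel₀ t hz]

theorem meanGHatFun_smul (h₁ : A₁.PosDef) (h₂ : A₂.PosDef) (hz : z ≠ 0) (hc : 0 < c) :
    meanGHatFun t z (c • A₁) A₂ = c ^ t • meanGHatFun t z A₁ A₂ := by
  have hpos := Real.rpow_pos_of_pos hc (1 / z)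
  have hexp : 1 / z * t * z = t := by field_simp
  rw [meanGHatFun, mpow_smul h₁ hc, kuboAndo_smul (mpow_posDef h₁ _) (mpow_posDef h₂ _) hpos,
    mpow_smul (kuboAndo_posDef t (mpow_posDef h₂ _) (mpow_posDef h₁ _))
      (Real.rpow_pos_of_pos hpos t), ← Real.rpow_mul hc.le, ← Real.rpow_mul hc.le, hexp,
    meanGHatFun]

theorem isHermitian_add_smul_mlog (s t : ℝ) (A₁ A₂ : Op d) :
    (s • mlog A₁ + t • mlog A₂).IsHermitian :=
  ((mlog_isHermitian A₁).smul (.all s)).add ((mlog_isHermitian A₂).smul (.all t))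

theorem meanGHatTopFun_smul (h₁ : A₁.PosDef) (hc : 0 < c) :
    meanGHatTopFun t (c • A₁) A₂ = c ^ t • meanGHatTopFun t A₁ A₂ := by
  rw [meanGHatTopFun, mlog_smul h₁ hc, smul_add, smul_smul, add_assoc,
    mexp_smul_one_add (isHermitian_add_smul_mlog t (1 - t) A₁ A₂), mul_comm t,
    ← Real.rpow_def_of_pos hc, meanGHatTopFun]

end Homogeneity

section Determinant

variable {d : ℕ} {A B : Op d}

theorem exists_conj_cfc_eq_diagonal (hA : A.IsHermitian) :
    ∃ U ∈ Matrix.unitaryGroup (Fin d) ℂ, ∃ l : Fin d → ℝ,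
      ∀ f : ℝ → ℝ, Uᴴ * cfc f A * U = Matrix.diagonal fun i => (f (l i) : ℂ) := by
  refine ⟨hA.eigenvectorUnitary, hA.eigenvectorUnitary.2, hA.eigenvalues, fun f => ?_⟩
  set U : Op d := (hA.eigenvectorUnitary : Op d)
  have hU : Uᴴ * U = 1 := Matrix.mem_unitaryGroup_iff'.1 hA.eigenvectorUnitary.2
  have hspec : cfc f A = U * Matrix.diagonal (fun i => (f (hA.eigenvalues i) : ℂ)) * Uᴴ := by
    rw [hA.cfc_eq]
    rfl
  rw [hspec, mul_assoc, mul_assoc, mul_assoc, hU, mul_one, ← mul_assoc, hU, one_mul]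

/-- The logarithm of the absolute value of the determinant. It turns the multiplicativity of `det`
into additivity and is homogeneous under `mpow`. -/
noncomputable def logDet (A : Op d) : ℝ := Real.log ‖A.det‖

theorem norm_det_pos (hA : IsUnit A) : 0 < ‖A.det‖ :=
  norm_pos_iff.2 ((Matrix.isUnit_iff_isUnit_det A).1 hA).ne_zero

theorem logDet_mul (hA : IsUnit A) (hB : IsUnit B) : logDet (A * B) = logDet A + logDet B := by
  rw [logDet, Matrix.det_mul, norm_mul, Real.log_mul (norm_det_pos hA).ne' (norm_det_pos hB).ne',
    logDet, logDet]

theorem logDet_sandwich (hA : A.PosDef) (hB : B.PosDef) :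
    logDet (A * B * A) = 2 * logDet A + logDet B := by
  rw [logDet_mul (hA.isUnit.mul hB.isUnit) hA.isUnit, logDet_mul hA.isUnit hB.isUnit]
  ring

theorem logDet_diagonal {b : Fin d → ℝ} (hb : ∀ i, 0 < b i) :
    logDet (Matrix.diagonal fun i => (b i : ℂ)) = ∑ i, Real.log (b i) := by
  rw [logDet, Matrix.det_diagonal, ← Complex.ofReal_prod, Complex.norm_real,
    Real.norm_of_nonneg (Finset.prod_nonneg fun i _ => (hb i).le),
    Real.log_prod fun i _ => (hb i).ne']

theorem logDet_mexp (hA : A.IsHermitian) : logDet (mexp A) = A.trace.re := by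
  obtain ⟨U, hU, l, hl⟩ := exists_conj_cfc_eq_diagonal hA
  have hUU : U * Uᴴ = 1 := Matrix.mem_unitaryGroup_iff.1 hU
  have htrace : A.trace = ∑ i, (l i : ℂ) := by
    rw [← Matrix.trace_diagonal, ← hl fun x => x, cfc_id' ℝ A hA.isSelfAdjoint,
      Matrix.trace_mul_cycle, hUU, one_mul]
  have hdet : (mexp A).det = (Uᴴ * mexp A * U).det := by
    rw [Matrix.det_mul_right_comm, ← Matrix.star_eq_conjTranspose,
      Matrix.mem_unitaryGroup_iff'.1 hU, one_mul]
  have hdiag := logDet_diagonal fun i => Real.exp_pos (l i)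
  simp only [Real.log_exp] at hdiag
  rw [logDet, hdet, mexp, hl, ← logDet, hdiag, htrace, ← Complex.ofReal_sum, Complex.ofReal_re]

theorem logDet_mpow (hA : A.PosDef) (p : ℝ) : logDet (mpow A p) = p * logDet A := by
  have hH := mlog_isHermitian A
  rw [mpow_eq_mexp hA, logDet_mexp (hH.smul (.all p)), Matrix.trace_smul, Complex.smul_re,
    ← logDet_mexp hH, mexp_mlog hA, smul_eq_mul]

theorem logDet_kuboAndo (t : ℝ) {A₁ A₂ : Op d} (h₁ : A₁.PosDef) (h₂ : A₂.PosDef) :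
    logDet (kuboAndo t A₂ A₁) = t * logDet A₁ + (1 - t) * logDet A₂ := by
  have hT := mpow_posDef h₂ (-(1 / 2))
  have hM := sandwich_posDef hT h₁
  rw [kuboAndo, logDet_sandwich (mpow_posDef h₂ _) (mpow_posDef hM _), logDet_mpow hM,
    logDet_sandwich hT h₁, logDet_mpow h₂, logDet_mpow h₂]
  ring

theorem logDet_meanGTildeFun (t : ℝ) {z : ℝ} (hz : z ≠ 0) {A₁ A₂ : Op d} (h₁ : A₁.PosDef)
    (h₂ : A₂.PosDef) :
    logDet (meanGTildeFun t z A₁ A₂) = t * logDet A₁ + (1 - t) * logDet A₂ := by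
  have hX := mpow_posDef h₂ ((1 - t) / (2 * z))
  have hY := mpow_posDef h₁ (t / z)
  rw [meanGTildeFun, logDet_mpow (sandwich_posDef hX hY), logDet_sandwich hX hY, logDet_mpow h₁,
    logDet_mpow h₂]
  field_simp
  ring

theorem logDet_meanGHatFun (t : ℝ) {z : ℝ} (hz : z ≠ 0) {A₁ A₂ : Op d} (h₁ : A₁.PosDef)
    (h₂ : A₂.PosDef) : logDet (meanGHatFun t z A₁ A₂) = t * logDet A₁ + (1 - t) * logDet A₂ := by
  have hX := mpow_posDef h₁ (1 / z)
  have hY := mpow_posDef h₂ (1 / z)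
  rw [meanGHatFun, logDet_mpow (kuboAndo_posDef t hY hX), logDet_kuboAndo t hX hY, logDet_mpow h₁,
    logDet_mpow h₂]
  field_simp

theorem logDet_meanGHatTopFun (t : ℝ) {A₁ A₂ : Op d} (h₁ : A₁.PosDef) (h₂ : A₂.PosDef) :
    logDet (meanGHatTopFun t A₁ A₂) = t * logDet A₁ + (1 - t) * logDet A₂ := by
  have htrace : ∀ {A : Op d}, A.PosDef → (mlog A).trace.re = logDet A := fun {A} hA => by
    rw [← logDet_mexp (mlog_isHermitian A), mexp_mlog hA]
  rw [meanGHatTopFun, logDet_mexp (isHermitian_add_smul_mlog t (1 - t) A₁ A₂), Matrix.trace_add,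
    Complex.add_re, Matrix.trace_smul, Matrix.trace_smul, Complex.smul_re, Complex.smul_re,
    htrace h₁, htrace h₂, smul_eq_mul, smul_eq_mul]

end Determinant

section SimultaneousDiagonalization

variable {d : ℕ} {A B : Op d}

theorem exists_simultaneous_diagonal (hA : A.IsHermitian) (hB : B.PosDef) :
    ∃ S : Op d, IsUnit S ∧ Sᴴ * B * S = 1 ∧ ∃ b : Fin d → ℝ,
      Sᴴ * A * S = Matrix.diagonal (fun i => (b i : ℂ)) ∧
      ∀ t, Sᴴ * kuboAndo t B A * S = Matrix.diagonal fun i => ((b i ^ t : ℝ) : ℂ) := by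
  set T := mpow B (-(1 / 2))
  have hTpos : T.PosDef := mpow_posDef hB _
  have hM : (T * A * T).IsHermitian := by
    simpa only [hTpos.isHermitian.eq] using Matrix.isHermitian_conjTranspose_mul_mul T hA
  obtain ⟨U, hU, b, hdiag⟩ := exists_conj_cfc_eq_diagonal hM
  have hUU : Uᴴ * U = 1 := Matrix.mem_unitaryGroup_iff'.1 hU
  have hconj (M : Op d) : (T * U)ᴴ * M * (T * U) = Uᴴ * (T * M * T) * U := by
    simp only [Matrix.conjTranspose_mul, hTpos.isHermitian.eq, mul_assoc]
  refine ⟨T * U, hTpos.isUnit.mul (.of_mul_eq_one _ (Matrix.mem_unitaryGroup_iff.1 hU)), ?_, b,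
    ?_, fun t => ?_⟩
  · rw [hconj, sandwich_mpow_neg_half hB, mul_one, hUU]
  · rw [hconj, ← hdiag fun x => x, cfc_id' ℝ _ hM.isSelfAdjoint]
  · rw [hconj, sandwich_kuboAndo t A hB, mpow, hdiag]

theorem conjTranspose_conj_mono {m : Type*} [Fintype m] (S : Matrix m m ℂ)
    {M N : Matrix m m ℂ} (h : M ≤ N) : Sᴴ * M * S ≤ Sᴴ * N * S := by
  rw [Matrix.le_iff, ← sub_mul, ← mul_sub]
  exact (Matrix.le_iff.1 h).conjTranspose_mul_mul_same S

theorem conjTranspose_conj_le_conj_iff {S : Op d} (hS : IsUnit S) :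
    Sᴴ * A * S ≤ Sᴴ * B * S ↔ A ≤ B := by
  rw [Matrix.le_iff, Matrix.le_iff, ← sub_mul, ← mul_sub]
  exact Matrix.IsUnit.posSemidef_star_left_conjugate_iff hS

theorem diagonal_le_diagonal_iff {ι : Type*} [Finite ι] [DecidableEq ι] {a b : ι → ℝ} :
    Matrix.diagonal (fun i => (a i : ℂ)) ≤ Matrix.diagonal (fun i => (b i : ℂ)) ↔
      ∀ i, a i ≤ b i := by
  simp only [Matrix.le_iff, Matrix.diagonal_sub, Matrix.posSemidef_diagonal_iff, sub_nonneg,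
    Complex.real_le_real]

theorem diagonal_le_one_iff {ι : Type*} [Finite ι] [DecidableEq ι] {a : ι → ℝ} :
    Matrix.diagonal (fun i => (a i : ℂ)) ≤ 1 ↔ ∀ i, a i ≤ 1 := by
  simpa only [Complex.ofReal_one, Matrix.diagonal_one] using
    diagonal_le_diagonal_iff (a := a) (b := fun _ => 1)

theorem forall_pos_of_conj_eq_diagonal (hA : A.PosDef) {S : Op d} (hS : IsUnit S) {b : Fin d → ℝ}
    (hb : Sᴴ * A * S = Matrix.diagonal fun i => (b i : ℂ)) (i : Fin d) : 0 < b i := by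
  have hpos : (Sᴴ * A * S).PosDef := (Matrix.IsUnit.posDef_star_left_conjugate_iff hS).2 hA
  rw [hb, Matrix.posDef_diagonal_iff] at hpos
  exact_mod_cast hpos i

theorem eq_of_le_of_logDet_eq (hA : A.PosDef) (hB : B.PosDef) (hle : A ≤ B)
    (hdet : logDet A = logDet B) : A = B := by
  obtain ⟨S, hS, hSB, b, hSA, -⟩ := exists_simultaneous_diagonal hA.isHermitian hB
  have hb := forall_pos_of_conj_eq_diagonal hA hS hSA
  have hb1 : ∀ i, b i ≤ 1 := by
    rwa [← conjTranspose_conj_le_conj_iff hS, hSA, hSB, diagonal_le_one_iff] at hle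
  have hS' : IsUnit Sᴴ := hS.star
  have hsum : ∑ i, Real.log (b i) = 0 := by
    rw [← logDet_diagonal hb, ← hSA, logDet_mul (hS'.mul hA.isUnit) hS, logDet_mul hS' hA.isUnit,
      hdet, ← logDet_mul hS' hB.isUnit, ← logDet_mul (hS'.mul hB.isUnit) hS, hSB, logDet]
    simp
  have hlog : ∀ i, Real.log (b i) = 0 := fun i =>
    (Finset.sum_eq_zero_iff_of_nonpos fun i _ => Real.log_nonpos (hb i).le (hb1 i)).1 hsum i
      (Finset.mem_univ i)
  have hone : Sᴴ * A * S = Sᴴ * B * S := by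
    simp only [hSA, hSB, Real.eq_one_of_pos_of_log_eq_zero (hb _) (hlog _), Complex.ofReal_one,
      Matrix.diagonal_one]
  exact hS'.mul_left_cancel (hS.mul_right_cancel hone)

end SimultaneousDiagonalization

section TensorPower

variable {d : ℕ}

theorem tensorPow_mul (A B : Op d) (n : ℕ) :
    tensorPow (A * B) n = tensorPow A n * tensorPow B n := by
  ext i j
  simp only [tensorPow, Matrix.mul_apply, Matrix.of_apply, Finset.prod_univ_sum,
    Fintype.piFinset_univ, Finset.prod_mul_distrib]

theorem tensorPow_conjTranspose (A : Op d) (n : ℕ) : tensorPow Aᴴ n = (tensorPow A n)ᴴ := by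
  ext i j
  simp only [tensorPow, Matrix.of_apply, Matrix.conjTranspose_apply, star_prod]

theorem tensorPow_diagonal (b : Fin d → ℝ) (n : ℕ) :
    tensorPow (Matrix.diagonal fun i => (b i : ℂ)) n =
      Matrix.diagonal fun i => ((∏ k, b (i k) : ℝ) : ℂ) := by
  ext i j
  simp only [tensorPow, Matrix.of_apply, Matrix.diagonal_apply]
  split_ifs with h
  · simp [h]
  · obtain ⟨k, hk⟩ := Function.ne_iff.1 h
    exact Finset.prod_eq_zero (Finset.mem_univ k) (if_neg hk)

theorem tensorPow_one (n : ℕ) : tensorPow (1 : Op d) n = 1 := by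
  simpa using tensorPow_diagonal (fun _ : Fin d => 1) n

theorem tensorPow_smul (c : ℝ) (A : Op d) (n : ℕ) :
    tensorPow (c • A) n = c ^ n • tensorPow A n := by
  ext i j
  simp [tensorPow, Finset.prod_mul_distrib]

theorem tensorPow_nonneg {A : Op d} (hA : A.PosSemidef) (n : ℕ) : 0 ≤ tensorPow A n := by
  obtain ⟨Y, hY⟩ := CStarAlgebra.nonneg_iff_eq_star_mul_self.1 (Matrix.nonneg_iff_posSemidef.2 hA)
  rw [hY, Matrix.star_eq_conjTranspose, tensorPow_mul, tensorPow_conjTranspose]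
  exact (Matrix.posSemidef_conjTranspose_mul_self _).nonneg

theorem tensorPow_conj (S A : Op d) (n : ℕ) :
    tensorPow (Sᴴ * A * S) n = (tensorPow S n)ᴴ * tensorPow A n * tensorPow S n := by
  rw [tensorPow_mul, tensorPow_mul, tensorPow_conjTranspose]

theorem le_one_of_forall_eventually_pow_le {b : ℝ}
    (h : ∀ δ > 1, ∃ C, ∀ᶠ n : ℕ in atTop, b ^ n ≤ C * δ ^ n) : b ≤ 1 := by
  by_contra! hb
  obtain ⟨δ, hδ, hδb⟩ := exists_between hb
  obtain ⟨C, hC⟩ := h δ hδ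
  have hδ0 : 0 < δ := one_pos.trans hδ
  have : 0 < b := one_pos.trans hb
  have hO : (fun n : ℕ => b ^ n) =O[atTop] fun n => δ ^ n := by
    refine .of_bound C (hC.mono fun n hn => ?_)
    rwa [Real.norm_of_nonneg (by positivity), Real.norm_of_nonneg (by positivity)]
  exact (isLittleO_pow_pow_of_lt_left hδ0.le hδb).not_isBigO
    (Frequently.of_forall fun n => (pow_pos hδ0 n).ne') hO

theorem le_of_forall_eventually_tensorPow_le {A B : Op d} (hA : A.IsHermitian) (hB : B.PosDef)
    (h : ∀ δ : ℝ, 1 < δ → ∃ C : ℝ, ∀ᶠ n in atTop,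
      tensorPow A n ≤ (C * δ ^ n) • tensorPow B n) : A ≤ B := by
  obtain ⟨S, hS, hSB, b, hSA, -⟩ := exists_simultaneous_diagonal hA hB
  rw [← conjTranspose_conj_le_conj_iff hS, hSA, hSB, diagonal_le_one_iff]
  refine fun i => le_one_of_forall_eventually_pow_le fun δ hδ => ?_
  obtain ⟨C, hC⟩ := h δ hδ
  refine ⟨C, hC.mono fun n hn => ?_⟩
  have hdiag : Matrix.diagonal (fun i : Fin n → Fin d => ((∏ k, b (i k) : ℝ) : ℂ)) ≤
      Matrix.diagonal fun _ => ((C * δ ^ n : ℝ) : ℂ) := by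
    have hconj := conjTranspose_conj_mono (tensorPow S n) hn
    rw [mul_smul_comm, smul_mul_assoc, ← tensorPow_conj, ← tensorPow_conj, hSA, hSB,
      tensorPow_diagonal, tensorPow_one] at hconj
    rwa [← Matrix.smul_one_eq_diagonal, Complex.coe_smul]
  simpa only [Finset.prod_const, Finset.card_univ, Fintype.card_fin] using
    diagonal_le_diagonal_iff.1 hdiag fun _ => i

end TensorPower

section AMBound

theorem matIntegral_le_smul_sum {Y m : Type*} [Fintype Y] [MeasurableSpace Y]
    [MeasurableSingletonClass Y] {μ : Measure Y} {F : Y → Matrix m m ℂ} (hF : ∀ y, 0 ≤ F y)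
    (hint : ∀ i j, Integrable (fun y => F y i j) μ) {r : ℝ} (hr : 0 ≤ r)
    (hμ : μ Set.univ ≤ ENNReal.ofReal r) : matIntegral μ F ≤ r • ∑ y, F y := by
  have hsum : matIntegral μ F = ∑ y, μ.real {y} • F y := by
    ext i j
    simp [matIntegral, integral_fintype (hint i j), Matrix.sum_apply]
  have hmass : ∀ y, μ.real {y} ≤ r := fun y =>
    ENNReal.toReal_le_of_le_ofReal hr ((measure_mono (Set.subset_univ _)).trans hμ)
  rw [hsum, Finset.smul_sum]
  refine Finset.sum_le_sum fun y _ => sub_nonneg.1 ?_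
  rw [← sub_smul]
  exact ((Matrix.nonneg_iff_posSemidef.1 (hF y)).smul (sub_nonneg.2 (hmass y))).nonneg

theorem eventually_measure_univ_le {Y : Type*} [MeasurableSpace Y] {μ : ℕ → Measure Y}
    (hμ : limsup (fun n : ℕ => ENNReal.log (μ n Set.univ) / (n : EReal)) atTop ≤ 0)
    {δ : ℝ} (hδ : 1 < δ) : ∀ᶠ n in atTop, μ n Set.univ ≤ ENNReal.ofReal (δ ^ n) := by
  have hlt : limsup (fun n : ℕ => ENNReal.log (μ n Set.univ) / (n : EReal)) atTop <
      (Real.log δ : EReal) := hμ.trans_lt (EReal.coe_pos.2 (Real.log_pos hδ))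
  filter_upwards [eventually_lt_of_limsup_lt hlt, eventually_ge_atTop 1] with n hn hn1
  rw [EReal.div_lt_iff (by exact_mod_cast hn1) (EReal.natCast_ne_top n)] at hn
  rw [← ENNReal.log_le_log_iff, ENNReal.log_ofReal_of_pos (pow_pos (one_pos.trans hδ) n),
    Real.log_pow, mul_comm]
  exact_mod_cast hn.le

theorem eventually_tensorPow_le_of_asympIndivAMBounded {Y : Type*} [Fintype Y] [MeasurableSpace Y]
    [MeasurableSingletonClass Y] {G : PosOpFun Y} (hG : G.AsympIndivAMBounded) {d : ℕ}
    {A : Y → Op d} (hA : A ∈ G.dom d) {δ : ℝ} (hδ : 1 < δ) :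
    ∀ᶠ n : ℕ in atTop, tensorPow (G.toFun d A) n ≤ δ ^ n • ∑ y, tensorPow (A y) n := by
  obtain ⟨μ, hbound, hlim⟩ := hG d A hA
  filter_upwards [eventually_measure_univ_le hlim hδ, eventually_ge_atTop 1] with n hμ hn
  obtain ⟨hint, hle⟩ := hbound n hn
  exact hle.trans <| matIntegral_le_smul_sum
    (fun y => tensorPow_nonneg (G.dom_posSemidef d A hA y) n) hint
    (pow_nonneg (one_pos.trans hδ).le n) hμ

end AMBound

section Pinching

variable {m σ : Type*}

theorem conj_sum_le_card_smul_sum_conj [Fintype m] {M : Matrix m m ℂ} (hM : 0 ≤ M) (J : Finset σ)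
    (P : σ → Matrix m m ℂ) :
    (∑ s ∈ J, P s)ᴴ * M * ∑ s ∈ J, P s ≤ J.card • ∑ s ∈ J, (P s)ᴴ * M * P s := by
  have hcross : ∑ s ∈ J, ∑ r ∈ J, (P r)ᴴ * M * P s = (∑ s ∈ J, P s)ᴴ * M * ∑ s ∈ J, P s := by
    simp only [Matrix.conjTranspose_sum, Finset.sum_mul, Finset.mul_sum]
  have hcross' := hcross
  rw [Finset.sum_comm] at hcross'
  have hvariance : J.card • ∑ s ∈ J, (P s)ᴴ * M * P s - (∑ s ∈ J, P s)ᴴ * M * ∑ s ∈ J, P s =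
      (2⁻¹ : ℝ) • ∑ s ∈ J, ∑ r ∈ J, (P s - P r)ᴴ * M * (P s - P r) := by
    rw [eq_inv_smul_iff₀ two_ne_zero]
    simp only [Matrix.conjTranspose_sub, sub_mul, mul_sub, Finset.sum_sub_distrib,
      Finset.sum_const, hcross, hcross', Finset.smul_sum, two_smul]
    abel
  rw [← sub_nonneg, hvariance, Matrix.nonneg_iff_posSemidef]
  refine .smul (Matrix.posSemidef_sum _ fun s _ => Matrix.posSemidef_sum _ fun r _ => ?_) (by simp)
  exact (Matrix.nonneg_iff_posSemidef.1 hM).conjTranspose_mul_mul_same _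

theorem le_card_smul_diagonal_of_forall_le [Finite m] [DecidableEq m] {M : Matrix m m ℂ}
    (hM : 0 ≤ M) {J : Finset σ} {w : σ → m → ℝ}
    (hw : ∀ s ∈ J, M ≤ Matrix.diagonal fun i => (w s i : ℂ)) {κ : m → σ} (hκ : ∀ i, κ i ∈ J) :
    M ≤ J.card • Matrix.diagonal fun i => (w (κ i) i : ℂ) := by
  classical
  cases nonempty_fintype m
  set P : σ → Matrix m m ℂ := fun s => Matrix.diagonal fun i => if κ i = s then 1 else 0 with hP
  have hPsum : ∑ s ∈ J, P s = 1 := by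
    ext i j
    simp [hP, Matrix.sum_apply, Matrix.diagonal_apply, Matrix.one_apply, hκ]
  have hPw : ∑ s ∈ J, (P s)ᴴ * Matrix.diagonal (fun i => (w s i : ℂ)) * P s =
      Matrix.diagonal fun i => (w (κ i) i : ℂ) := by
    ext i j
    simp [hP, Matrix.sum_apply, Matrix.diagonal_apply, Matrix.diagonal_conjTranspose, hκ]
  calc M = (∑ s ∈ J, P s)ᴴ * M * ∑ s ∈ J, P s := by simp [hPsum]
    _ ≤ J.card • ∑ s ∈ J, (P s)ᴴ * M * P s := conj_sum_le_card_smul_sum_conj hM J P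
    _ ≤ J.card • ∑ s ∈ J, (P s)ᴴ * Matrix.diagonal (fun i => (w s i : ℂ)) * P s :=
      nsmul_le_nsmul_right (Finset.sum_le_sum fun s hs => conjTranspose_conj_mono _ (hw s hs)) _
    _ = J.card • Matrix.diagonal fun i => (w (κ i) i : ℂ) := by rw [hPw]

end Pinching

section KuboAndoBound

theorem exists_finset_max_exp_le {K : Set ℝ} (hK : IsCompact K) (t : ℝ) {δ : ℝ} (hδ : 1 < δ) :
    ∃ J : Finset ℝ, ∀ y ∈ K, ∃ u ∈ J, max (Real.exp (y - u)) 1 ≤ δ * Real.exp (t * (y - u)) := by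
  obtain ⟨J, -, hJ⟩ := hK.elim_nhds_subcover
    (fun u => {y | max (Real.exp (y - u)) 1 < δ * Real.exp (t * (y - u))}) fun u _ => by
      refine (isOpen_lt (by fun_prop) (by fun_prop)).mem_nhds ?_
      simpa using hδ
  refine ⟨J, fun y hy => ?_⟩
  obtain ⟨u, hu, hyu⟩ := Set.mem_iUnion₂.1 (hJ hy)
  exact ⟨u, hu, le_of_lt hyu⟩

theorem exists_finset_pow_mul_prod_add_one_le {ι : Type*} [Finite ι] {b : ι → ℝ}
    (hb : ∀ i, 0 < b i) (t : ℝ) {δ : ℝ} (hδ : 1 < δ) :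
    ∃ J : Finset ℝ, (∀ c ∈ J, 0 < c) ∧ ∀ n, n ≠ 0 → ∀ i : Fin n → ι, ∃ c ∈ J,
      c ^ n * ∏ k, b (i k) + 1 ≤ 2 * δ ^ n * ((c ^ t) ^ n * ∏ k, b (i k) ^ t) := by
  obtain ⟨R, hR⟩ := (Set.finite_range fun i => |Real.log (b i)|).bddAbove
  obtain ⟨J, hJ⟩ := exists_finset_max_exp_le (isCompact_Icc (a := -R) (b := R)) t hδ
  refine ⟨J.image fun u => Real.exp (-u), by simp [Real.exp_pos], fun n hn i => ?_⟩
  have hn0 : (0 : ℝ) < n := by positivity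
  set y := (∑ k, Real.log (b (i k))) / n with hy
  have hyR : |y| ≤ R := by
    rw [hy, abs_div, Nat.abs_cast, div_le_iff₀ hn0, mul_comm]
    calc |∑ k, Real.log (b (i k))| ≤ ∑ k, |Real.log (b (i k))| := Finset.abs_sum_le_sum_abs _ _
      _ ≤ ∑ _ : Fin n, R := Finset.sum_le_sum fun k _ => hR ⟨i k, rfl⟩
      _ = n * R := by simp
  obtain ⟨u, hu, hmax⟩ := hJ y (abs_le.1 hyR)
  have hny : n * y = ∑ k, Real.log (b (i k)) := mul_div_cancel₀ _ hn0.ne'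
  have hprod (s : ℝ) : ∏ k, b (i k) ^ s = Real.exp (s * y) ^ n := by
    simp only [Real.rpow_def_of_pos (hb _)]
    rw [← Real.exp_sum, ← Finset.sum_mul, ← hny, ← Real.exp_nat_mul]
    ring_nf
  refine ⟨Real.exp (-u), Finset.mem_image_of_mem _ hu, ?_⟩
  have hlhs : Real.exp (-u) ^ n * ∏ k, b (i k) = Real.exp (y - u) ^ n := by
    have hprod1 := hprod 1
    simp only [Real.rpow_one, one_mul] at hprod1
    rw [hprod1, ← mul_pow, ← Real.exp_add, neg_add_eq_sub]
  have hrhs : (Real.exp (-u) ^ t) ^ n * ∏ k, b (i k) ^ t = Real.exp (t * (y - u)) ^ n := by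
    rw [hprod, ← mul_pow, ← Real.exp_mul, ← Real.exp_add]
    ring_nf
  rw [hlhs, hrhs, mul_assoc, ← mul_pow, two_mul]
  exact add_le_add (pow_le_pow_left₀ (Real.exp_pos _).le ((le_max_left _ _).trans hmax) n)
    (one_le_pow₀ ((le_max_right _ _).trans hmax))

variable {d : ℕ} {X A₁ A₂ : Op d}

theorem tensorPow_le_diagonal_of_tensorPow_smul_le {b : Fin d → ℝ} {c r s : ℝ} {n : ℕ} (hs : 0 < s)
    (h : tensorPow (s • X) n ≤
      r • (tensorPow (c • Matrix.diagonal fun i => (b i : ℂ)) n + tensorPow 1 n)) :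
    tensorPow X n ≤ Matrix.diagonal fun i =>
      ((r * (c ^ n * ∏ k, b (i k) + 1) / s ^ n : ℝ) : ℂ) := by
  have hs' : 0 < s ^ n := pow_pos hs n
  have hle := smul_le_smul_of_nonneg_left h (inv_nonneg.2 hs'.le)
  rw [tensorPow_smul, inv_smul_smul₀ hs'.ne', tensorPow_smul, tensorPow_diagonal, tensorPow_one]
    at hle
  refine hle.trans_eq (Matrix.ext fun i j => ?_)
  by_cases hij : i = j
  · simp [hij]
    ring
  · simp [hij]

theorem le_diagonal_rpow_of_forall_eventually_tensorPow_le (t : ℝ) (hX : X.PosSemidef)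
    {b : Fin d → ℝ} (hb : ∀ i, 0 < b i)
    (h : ∀ c : ℝ, 0 < c → ∀ δ : ℝ, 1 < δ → ∀ᶠ n : ℕ in atTop, tensorPow (c ^ t • X) n ≤
      δ ^ n • (tensorPow (c • Matrix.diagonal fun i => (b i : ℂ)) n + tensorPow 1 n)) :
    X ≤ Matrix.diagonal fun i => ((b i ^ t : ℝ) : ℂ) := by
  have hK : (Matrix.diagonal fun i => ((b i ^ t : ℝ) : ℂ)).PosDef :=
    Matrix.posDef_diagonal_iff.2 fun i => by exact_mod_cast Real.rpow_pos_of_pos (hb i) t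
  refine le_of_forall_eventually_tensorPow_le hX.isHermitian hK fun δ hδ => ?_
  have hδ1 : 1 < √δ := Real.lt_sqrt_of_sq_lt (by simpa using hδ)
  obtain ⟨J, hJ0, hJ⟩ := exists_finset_pow_mul_prod_add_one_le hb t hδ1
  refine ⟨J.card * 2, ?_⟩
  filter_upwards [(Finset.eventually_all J).2 fun c hc => h c (hJ0 c hc) _ hδ1,
    eventually_ne_atTop 0] with n hn hn0
  set w : ℝ → (Fin n → Fin d) → ℝ :=
    fun c i => √δ ^ n * (c ^ n * ∏ k, b (i k) + 1) / (c ^ t) ^ n with hw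
  have hXw : ∀ c ∈ J, tensorPow X n ≤ Matrix.diagonal fun i => (w c i : ℂ) := fun c hc =>
    tensorPow_le_diagonal_of_tensorPow_smul_le (Real.rpow_pos_of_pos (hJ0 c hc) t) (hn c hc)
  choose κ hκJ hκ using hJ n hn0
  have hwκ : ∀ i, w (κ i) i ≤ 2 * δ ^ n * ∏ k, b (i k) ^ t := fun i => by
    have hr : 0 < (κ i ^ t) ^ n := pow_pos (Real.rpow_pos_of_pos (hJ0 _ (hκJ i)) t) n
    rw [hw, div_le_iff₀ hr]
    calc √δ ^ n * (κ i ^ n * ∏ k, b (i k) + 1)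
        ≤ √δ ^ n * (2 * √δ ^ n * ((κ i ^ t) ^ n * ∏ k, b (i k) ^ t)) := by gcongr; exact hκ i
      _ = 2 * (√δ * √δ) ^ n * (∏ k, b (i k) ^ t) * (κ i ^ t) ^ n := by rw [mul_pow]; ring
      _ = 2 * δ ^ n * (∏ k, b (i k) ^ t) * (κ i ^ t) ^ n := by
        rw [Real.mul_self_sqrt (one_pos.trans hδ).le]
  calc tensorPow X n ≤ J.card • Matrix.diagonal fun i => (w (κ i) i : ℂ) :=
        le_card_smul_diagonal_of_forall_le (tensorPow_nonneg hX n) hXw hκJ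
    _ ≤ J.card • Matrix.diagonal fun i => ((2 * δ ^ n * ∏ k, b (i k) ^ t : ℝ) : ℂ) :=
        nsmul_le_nsmul_right (diagonal_le_diagonal_iff.2 hwκ) _
    _ = _ := by
        rw [tensorPow_diagonal]
        ext i j
        by_cases hij : i = j
        · simp [hij]
          ring
        · simp [hij]

theorem le_kuboAndo_of_forall_eventually_tensorPow_le (t : ℝ) (hX : X.PosSemidef)
    (h₁ : A₁.PosDef) (h₂ : A₂.PosDef)
    (h : ∀ c : ℝ, 0 < c → ∀ δ : ℝ, 1 < δ → ∀ᶠ n : ℕ in atTop, tensorPow (c ^ t • X) n ≤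
      δ ^ n • (tensorPow (c • A₁) n + tensorPow A₂ n)) : X ≤ kuboAndo t A₂ A₁ := by
  obtain ⟨S, hS, hS₂, b, hS₁, hSK⟩ := exists_simultaneous_diagonal h₁.isHermitian h₂
  rw [← conjTranspose_conj_le_conj_iff hS, hSK]
  refine le_diagonal_rpow_of_forall_eventually_tensorPow_le t (hX.conjTranspose_mul_mul_same S)
    (forall_pos_of_conj_eq_diagonal h₁ hS hS₁) fun c hc δ hδ => ?_
  filter_upwards [h c hc δ hδ] with n hn
  have hconj := conjTranspose_conj_mono (tensorPow S n) hn
  rwa [mul_smul_comm, smul_mul_assoc, mul_add, add_mul, ← tensorPow_conj, ← tensorPow_conj,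
    ← tensorPow_conj, mul_smul_comm, smul_mul_assoc, mul_smul_comm, smul_mul_assoc, hS₁, hS₂]
    at hconj

theorem le_kuboAndo_of_asympIndivAMBounded (t : ℝ) {F : ∀ d : ℕ, Op d → Op d → Op d} {hpos hconj}
    (hF : (ofFormula F hpos hconj).AsympIndivAMBounded) (hd : 0 < d)
    (h₁ : A₁.PosDef) (h₂ : A₂.PosDef)
    (hhom : ∀ c : ℝ, 0 < c → F d (c • A₁) A₂ = c ^ t • F d A₁ A₂) :
    F d A₁ A₂ ≤ kuboAndo t A₂ A₁ := by
  refine le_kuboAndo_of_forall_eventually_tensorPow_le t (hpos d A₁ A₂ h₁ h₂) h₁ h₂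
    fun c hc δ hδ => ?_
  have hmem : ![c • A₁, A₂] ∈ (ofFormula F hpos hconj).dom d :=
    ⟨hd, Fin.forall_fin_two.2 ⟨h₁.smul hc, h₂⟩⟩
  filter_upwards [eventually_tensorPow_le_of_asympIndivAMBounded hF hmem hδ] with n hn
  simpa only [ofFormula, Matrix.cons_val_zero, Matrix.cons_val_one, Fin.sum_univ_two, hhom c hc]
    using hn

end KuboAndoBound

section PauliPair

variable {d : ℕ} {S T J : Op d} {β : ℝ}

theorem mexp_smul_of_mul_self_eq_one (hJ : J.IsHermitian) (hJJ : J * J = 1) (a : ℝ) :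
    mexp (a • J) = Real.cosh a • 1 + Real.sinh a • J := by
  have hspec : ∀ x ∈ spectrum ℝ J, x * x = 1 := fun x hx => by
    have hx2 := spectrum.pow_mem_pow J 2 hx
    rw [pow_two, pow_two, hJJ, ← map_one (algebraMap ℝ (Op d)), spectrum.mem_iff, ← map_sub] at hx2
    by_contra hne
    exact hx2 ((sub_ne_zero.2 hne).isUnit.map _)
  have hexp : mexp (a • J) = cfc (fun x => Real.cosh a + Real.sinh a * x) J := by
    nth_rewrite 1 [← cfc_id' ℝ J hJ.isSelfAdjoint]
    rw [smul_cfc, mexp, cfc_cfc hJ]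
    refine cfc_congr fun x hx => ?_
    rcases mul_self_eq_one_iff.1 (hspec x hx) with rfl | rfl
    · simp [Real.cosh_add_sinh]
    · simp [← sub_eq_add_neg, Real.cosh_sub_sinh]
  rw [hexp, cfc_const_add _ _ J, ← smul_cfc, cfc_id' ℝ J hJ.isSelfAdjoint,
    Algebra.algebraMap_eq_smul_one]

theorem sinh_smul_mexp_smul (hJ : J.IsHermitian) (hJJ : J * J = 1) (t β : ℝ) :
    Real.sinh β • mexp ((t * β) • J) =
      Real.sinh (t * β) • mexp (β • J) + Real.sinh ((1 - t) * β) • 1 := by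
  have hsub : Real.sinh ((1 - t) * β) =
      Real.sinh β * Real.cosh (t * β) - Real.cosh β * Real.sinh (t * β) := by
    rw [← Real.sinh_sub]
    ring_nf
  simp only [mexp_smul_of_mul_self_eq_one hJ hJJ, hsub]
  module

theorem kuboAndo_eq_of_sandwich_eq_mexp {A₁ A₂ : Op d} (h₂ : A₂.PosDef) (hJ : J.IsHermitian)
    (hJJ : J * J = 1) (hβ : β ≠ 0)
    (hM : mpow A₂ (-(1 / 2)) * A₁ * mpow A₂ (-(1 / 2)) = mexp (β • J)) (t : ℝ) :
    kuboAndo t A₂ A₁ = (Real.sinh (t * β) / Real.sinh β) • A₁ +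
      (Real.sinh ((1 - t) * β) / Real.sinh β) • A₂ := by
  set R := mpow A₂ (1 / 2)
  have hRMR : R * mexp (β • J) * R = A₁ := by
    calc R * mexp (β • J) * R
        = (R * mpow A₂ (-(1 / 2))) * A₁ * (mpow A₂ (-(1 / 2)) * R) := by
          simp only [← hM, mul_assoc]
      _ = A₁ := by rw [mpow_mul_mpow_neg h₂, mpow_neg_mul_mpow h₂, one_mul, mul_one]
  have hRR : R * R = A₂ := by rw [mpow_mul_mpow h₂, add_halves, mpow_one h₂.isHermitian]
  have hsinh : Real.sinh β ≠ 0 := by rwa [Ne, Real.sinh_eq_zero]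
  have hscaled : Real.sinh β • kuboAndo t A₂ A₁ =
      Real.sinh (t * β) • A₁ + Real.sinh ((1 - t) * β) • A₂ := by
    rw [kuboAndo, hM, mpow_mexp (hJ.smul (.all β)), smul_smul, ← smul_mul_assoc, ← mul_smul_comm,
      sinh_smul_mexp_smul hJ hJJ, mul_add, add_mul, mul_smul_comm, smul_mul_assoc, hRMR,
      mul_smul_comm, smul_mul_assoc, mul_one, hRR]
  rw [← inv_smul_smul₀ hsinh (kuboAndo t A₂ A₁), hscaled, smul_add, smul_smul, smul_smul,
    inv_mul_eq_div, inv_mul_eq_div]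

/-- Two anticommuting Hermitian involutions, such as two Pauli matrices: the real span of `1`, `S`
and `T` is then explicitly computable, and `S` and `T` are as far from commuting as possible. -/
structure IsPauliPair (S T : Op d) : Prop where
  left_isHermitian : S.IsHermitian
  right_isHermitian : T.IsHermitian
  left_mul_self : S * S = 1
  right_mul_self : T * T = 1
  anticomm : T * S = -(S * T)

theorem isPauliPair_sigmaZ_sigmaX : IsPauliPair !![1, 0; 0, -1] !![0, 1; 1, 0] where
  left_isHermitian := by ext i j; fin_cases i <;> fin_cases j <;> simp
  right_isHermitian := by ext i j; fin_cases i <;> fin_cases j <;> simp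
  left_mul_self := by simp [Matrix.one_fin_two]
  right_mul_self := by simp [Matrix.one_fin_two]
  anticomm := by simp

namespace IsPauliPair

theorem symm (h : IsPauliPair S T) : IsPauliPair T S where
  left_isHermitian := h.right_isHermitian
  right_isHermitian := h.left_isHermitian
  left_mul_self := h.right_mul_self
  right_mul_self := h.left_mul_self
  anticomm := by rw [h.anticomm, neg_neg]

theorem mul_ne_zero (h : IsPauliPair S T) (hd : 0 < d) : S * T ≠ 0 := by
  have : NeZero d := ⟨hd.ne'⟩
  have hS : IsUnit S := .of_mul_eq_one _ h.left_mul_self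
  have hT : IsUnit T := .of_mul_eq_one _ h.right_mul_self
  exact (hS.mul hT).ne_zero

theorem mul_eq_mul_of_commute (h : IsPauliPair S T) (hd : 0 < d) {c x y c' x' y' : ℝ}
    (hcomm : Commute (c • 1 + x • S + y • T) (c' • 1 + x' • S + y' • T)) : x * y' = y * x' := by
  have hcomm' := sub_eq_zero.2 hcomm.eq
  have hbracket : (2 * (x * y' - y * x')) • (S * T) = 0 := by
    rw [← hcomm']
    simp only [mul_add, add_mul, smul_mul_assoc, mul_smul_comm, one_mul, mul_one, h.left_mul_self,
      h.right_mul_self, h.anticomm]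
    module
  have hzero := (smul_eq_zero.1 hbracket).resolve_right (h.mul_ne_zero hd)
  linarith

theorem sandwich_mexp (h : IsPauliPair S T) (u a : ℝ) :
    mexp (u • T) * mexp (a • S) * mexp (u • T) =
      (Real.cosh a * Real.cosh (2 * u)) • 1 + Real.sinh a • S +
        (Real.cosh a * Real.sinh (2 * u)) • T := by
  have hTST : S * T * T = S := by rw [mul_assoc, h.right_mul_self, mul_one]
  rw [mexp_smul_of_mul_self_eq_one h.right_isHermitian h.right_mul_self,
    mexp_smul_of_mul_self_eq_one h.left_isHermitian h.left_mul_self, Real.cosh_two_mul,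
    Real.sinh_two_mul]
  simp only [mul_add, add_mul, smul_mul_assoc, mul_smul_comm, one_mul, mul_one, h.anticomm,
    h.right_mul_self, neg_mul, hTST, smul_add, smul_smul, smul_neg]
  linear_combination (norm := module) Real.cosh_sq u • (Real.sinh a • S)

end IsPauliPair

end PauliPair

section KuboSlope

variable {d : ℕ} {S T : Op d} {f : ℝ → ℝ} {a b c t x y : ℝ}

/-- The hypotenuse of a right-angled hyperbolic triangle with legs `a` and `b`, given by the
hyperbolic Pythagorean theorem. It is the size of the Hermitian exponent of the relative operator
`e^{-bT/2} e^{aS} e^{-bT/2}` of a Pauli pair. -/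
noncomputable def hypotenuse (a b : ℝ) : ℝ := Real.arcosh (Real.cosh a * Real.cosh b)

theorem cosh_hypotenuse (a b : ℝ) :
    Real.cosh (hypotenuse a b) = Real.cosh a * Real.cosh b :=
  Real.cosh_arcosh (one_le_mul_of_one_le_of_one_le (Real.one_le_cosh a) (Real.one_le_cosh b))

theorem hypotenuse_comm (a b : ℝ) : hypotenuse a b = hypotenuse b a := by
  rw [hypotenuse, mul_comm, hypotenuse]

theorem hypotenuse_pos (ha : a ≠ 0) (b : ℝ) : 0 < hypotenuse a b :=
  Real.arcosh_pos (one_lt_mul_of_lt_of_le (Real.one_lt_cosh.2 ha) (Real.one_le_cosh b))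

theorem le_hypotenuse (ha : 0 < a) (b : ℝ) : a ≤ hypotenuse a b := by
  rw [← Real.cosh_strictMonoOn.le_iff_le ha.le (hypotenuse_pos ha.ne' b).le, cosh_hypotenuse]
  exact le_mul_of_one_le_right (Real.cosh_pos a).le (Real.one_le_cosh b)

theorem hypotenuse_le_add (ha : 0 < a) (hb : 0 ≤ b) : hypotenuse a b ≤ a + b := by
  rw [← Real.cosh_strictMonoOn.le_iff_le (hypotenuse_pos ha.ne' b).le (add_nonneg ha.le hb),
    cosh_hypotenuse, Real.cosh_add]
  exact le_add_of_nonneg_right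
    (mul_nonneg (Real.sinh_nonneg_iff.2 ha.le) (Real.sinh_nonneg_iff.2 hb))

/-- The ratio of the `S`- to the `T`-coordinate of the geometric mean
`kuboAndo t (mexp (b • T)) (mexp (a • S))` of a Pauli pair `S`, `T`. -/
noncomputable def kuboSlope (t a b : ℝ) : ℝ :=
  Real.sinh (t * hypotenuse a b) * Real.sinh a /
    (Real.sinh ((1 - t) * hypotenuse a b) * Real.sinh b)

namespace IsPauliPair

theorem smul_add_smul_mul_self (h : IsPauliPair S T) (x y : ℝ) :
    (x • S + y • T) * (x • S + y • T) = (x ^ 2 + y ^ 2) • 1 := by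
  simp only [mul_add, add_mul, smul_mul_assoc, mul_smul_comm, h.left_mul_self, h.right_mul_self,
    h.anticomm]
  module

theorem kuboAndo_mexp (h : IsPauliPair S T) (ha : a ≠ 0) (b t : ℝ) :
    kuboAndo t (mexp (b • T)) (mexp (a • S)) =
      (Real.sinh (t * hypotenuse a b) / Real.sinh (hypotenuse a b)) • mexp (a • S) +
        (Real.sinh ((1 - t) * hypotenuse a b) / Real.sinh (hypotenuse a b)) • mexp (b • T) := by
  set β := hypotenuse a b
  have hβ : β ≠ 0 := (hypotenuse_pos ha b).ne'
  have hsinh : Real.sinh β ≠ 0 := by rwa [Ne, Real.sinh_eq_zero]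
  set J := (Real.sinh a / Real.sinh β) • S + (-(Real.cosh a * Real.sinh b) / Real.sinh β) • T
    with hJdef
  have hJ : J.IsHermitian :=
    (h.left_isHermitian.smul (.all _)).add (h.right_isHermitian.smul (.all _))
  have hJJ : J * J = 1 := by
    rw [hJdef, h.smul_add_smul_mul_self, div_pow, div_pow, ← add_div, (div_eq_one_iff_eq
      (pow_ne_zero 2 hsinh)).2, one_smul]
    rw [Real.sinh_sq β, cosh_hypotenuse, neg_sq, mul_pow, mul_pow, Real.sinh_sq, Real.sinh_sq]
    ring
  refine kuboAndo_eq_of_sandwich_eq_mexp (mexp_posDef (h.right_isHermitian.smul (.all b))) hJ hJJ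
    hβ ?_ t
  rw [mpow_mexp (h.right_isHermitian.smul (.all b)), smul_smul, h.sandwich_mexp,
    mexp_smul_of_mul_self_eq_one hJ hJJ, cosh_hypotenuse, hJdef, smul_add, smul_smul, smul_smul,
    mul_div_cancel₀ _ hsinh, mul_div_cancel₀ _ hsinh, ← add_assoc,
    show 2 * (-(1 / 2) * b) = -b by ring, Real.cosh_neg, Real.sinh_neg, mul_neg]

theorem kuboAndo_mexp_comm (h : IsPauliPair S T) (ha : a ≠ 0) (hb : b ≠ 0) (t : ℝ) :
    kuboAndo t (mexp (b • T)) (mexp (a • S)) =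
      kuboAndo (1 - t) (mexp (a • S)) (mexp (b • T)) := by
  rw [h.kuboAndo_mexp ha, h.symm.kuboAndo_mexp hb, hypotenuse_comm b a, sub_sub_cancel, add_comm]

theorem exists_kuboAndo_mexp_eq (h : IsPauliPair S T) (ha : 0 < a) (hb : 0 < b) (ht : t < 1) :
    ∃ c y : ℝ, 0 < y ∧ kuboAndo t (mexp (b • T)) (mexp (a • S)) =
      c • 1 + (y * kuboSlope t a b) • S + y • T := by
  set β := hypotenuse a b with hβdef
  have hβ : 0 < β := hypotenuse_pos ha.ne' b
  have hsinhβ := Real.sinh_pos_iff.2 hβ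
  have hsinh := Real.sinh_pos_iff.2 (mul_pos (sub_pos.2 ht) hβ)
  have hsinhb := Real.sinh_pos_iff.2 hb
  set p := Real.sinh (t * β) / Real.sinh β with hp
  set q := Real.sinh ((1 - t) * β) / Real.sinh β with hq
  have hslope : q * Real.sinh b * kuboSlope t a b = p * Real.sinh a := by
    rw [kuboSlope, ← hβdef, hp, hq]
    field_simp
  refine ⟨p * Real.cosh a + q * Real.cosh b, q * Real.sinh b,
    mul_pos (div_pos hsinh hsinhβ) hsinhb, ?_⟩
  rw [h.kuboAndo_mexp ha.ne', mexp_smul_of_mul_self_eq_one h.left_isHermitian h.left_mul_self,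
    mexp_smul_of_mul_self_eq_one h.right_isHermitian h.right_mul_self, hslope]
  module

-- A function of an operator commutes with it, and commuting elements of the span of `1`, `S`, `T`
-- have proportional `S`- and `T`-coordinates.
theorem eq_mul_kuboSlope_of_cfc_eq_kuboAndo (h : IsPauliPair S T) (hd : 0 < d) (ha : 0 < a)
    (hb : 0 < b) (ht : t < 1)
    (hcfc : cfc f (c • 1 + x • S + y • T) = kuboAndo t (mexp (b • T)) (mexp (a • S))) :
    x = y * kuboSlope t a b := by
  obtain ⟨c', y', hy', hK⟩ := h.exists_kuboAndo_mexp_eq ha hb ht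
  have hH : (c • 1 + x • S + y • T).IsHermitian :=
    ((Matrix.isHermitian_one.smul (.all c)).add (h.left_isHermitian.smul (.all x))).add
      (h.right_isHermitian.smul (.all y))
  have hcomm : Commute (c • 1 + x • S + y • T) (c' • 1 + (y' * kuboSlope t a b) • S + y' • T) := by
    rw [← hK, ← hcfc]
    exact (hH.isSelfAdjoint.commute_cfc (Commute.refl _) f).symm
  have hcross := h.mul_eq_mul_of_commute hd hcomm
  exact mul_right_cancel₀ hy'.ne' (by linarith)

end IsPauliPair

end KuboSlope

section KuboSlopeGrowth

open Asymptotics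

variable {α : Type*} {l : Filter α} {u : α → ℝ} {t b s : ℝ}

theorem sinh_isTheta_exp : Real.sinh =Θ[atTop] Real.exp := by
  have hneg : (fun x : ℝ => Real.exp (-x)) =o[atTop] fun x : ℝ => Real.exp x := by
    rw [Real.isLittleO_exp_comp_exp_comp]
    simpa only [sub_neg_eq_add, id] using tendsto_id.atTop_add_atTop (tendsto_id (α := ℝ))
  have hsinh : Real.sinh = fun x => (1 / 2 : ℝ) * (Real.exp x - Real.exp (-x)) := by
    funext x
    rw [Real.sinh_eq]
    ring
  rw [hsinh, isTheta_const_mul_left one_half_pos.ne']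
  exact (IsEquivalent.refl.sub_isLittleO hneg).isTheta

theorem sinh_comp_isTheta_exp_comp (hu : Tendsto u l atTop) :
    (fun x => Real.sinh (u x)) =Θ[l] fun x => Real.exp (u x) :=
  ⟨sinh_isTheta_exp.1.comp_tendsto hu, sinh_isTheta_exp.2.comp_tendsto hu⟩

theorem tendsto_hypotenuse_atTop (b : ℝ) : Tendsto (fun a => hypotenuse a b) atTop atTop :=
  tendsto_atTop_mono' atTop
    ((eventually_gt_atTop 0).mono fun _ ha => le_hypotenuse ha b) tendsto_id

theorem sinh_mul_hypotenuse_isTheta (hs : 0 < s) (hb : 0 ≤ b) :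
    (fun a => Real.sinh (s * hypotenuse a b)) =Θ[atTop] fun a => Real.exp (s * a) := by
  refine (sinh_comp_isTheta_exp_comp ((tendsto_hypotenuse_atTop b).const_mul_atTop hs)).trans ?_
  refine Real.isTheta_exp_comp_exp_comp.2 (isBoundedUnder_of_eventually_le (a := s * b) ?_)
  filter_upwards [eventually_gt_atTop 0] with a ha
  rw [← mul_sub, abs_of_nonneg (mul_nonneg hs.le (sub_nonneg.2 (le_hypotenuse ha b)))]
  exact mul_le_mul_of_nonneg_left (sub_le_iff_le_add'.2 (hypotenuse_le_add ha hb)) hs.le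

theorem kuboSlope_isTheta (ht0 : 0 < t) (ht1 : t < 1) (hb : 0 < b) :
    (fun a => kuboSlope t a b) =Θ[atTop] fun a => Real.exp (2 * t * a) := by
  have hnum := (sinh_mul_hypotenuse_isTheta ht0 hb.le).mul sinh_isTheta_exp
  have hden := (sinh_mul_hypotenuse_isTheta (sub_pos.2 ht1) hb.le).mul
    (isTheta_const_const (l := atTop) (Real.sinh_pos_iff.2 hb).ne' (one_ne_zero (α := ℝ)))
  refine (hnum.div hden).trans_eventuallyEq (Eventually.of_forall fun a => ?_)
  simp only [mul_one, ← Real.exp_add, ← Real.exp_sub]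
  ring_nf

theorem not_kuboSlope_isBigO_of_isLittleO (ht0 : 0 < t) (ht1 : t < 1) (hb : 0 < b) {g : ℝ → ℝ}
    (hg : g =o[atTop] fun a => Real.exp (2 * t * a)) :
    ¬ (fun a => kuboSlope t a b) =O[atTop] g := fun hO =>
  isLittleO_irrefl (Frequently.of_forall fun _ => (Real.exp_pos _).ne')
    (((kuboSlope_isTheta ht0 ht1 hb).2.trans hO).trans_isLittleO hg)

theorem eq_one_of_forall_kuboSlope_mul_eq (ht0 : 0 < t) (ht1 : t < 1) (hb : 0 < b) (hs : 0 < s)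
    (h : ∀ a, 0 < a → kuboSlope t (s * a) (s * b) = kuboSlope t a b) : s = 1 := by
  have hscaled : (fun a => kuboSlope t (s * a) (s * b)) =Θ[atTop]
      fun a => Real.exp (2 * t * (s * a)) :=
    have htheta := kuboSlope_isTheta ht0 ht1 (mul_pos hs hb)
    have hlim : Tendsto (fun a => s * a) atTop atTop := tendsto_id.const_mul_atTop hs
    ⟨htheta.1.comp_tendsto hlim, htheta.2.comp_tendsto hlim⟩
  have hexp := (hscaled.symm.trans_eventuallyEq ((eventually_gt_atTop 0).mono h)).trans
    (kuboSlope_isTheta ht0 ht1 hb)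
  rw [Real.isTheta_exp_comp_exp_comp] at hexp
  by_contra hs1
  refine not_isBoundedUnder_of_tendsto_atTop ?_ hexp
  have hne : 0 < |2 * t * (s - 1)| := abs_pos.2 (by simp [ht0.ne', sub_ne_zero.2 hs1])
  refine (tendsto_abs_atTop_atTop.const_mul_atTop hne).congr fun a => ?_
  rw [← abs_mul]
  ring_nf

end KuboSlopeGrowth

section PauliPairMeans

variable {d : ℕ} {S T : Op d} {f : ℝ → ℝ} {a b c t x y z : ℝ}

namespace IsPauliPair

theorem left_mexp_posDef (h : IsPauliPair S T) (a : ℝ) : (mexp (a • S)).PosDef :=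
  mexp_posDef (h.left_isHermitian.smul (.all a))

theorem eq_mul_kuboSlope_of_cfc_le_kuboAndo (h : IsPauliPair S T) (hd : 0 < d) (ha : 0 < a)
    (hb : 0 < b) (ht : t < 1) (hpos : (cfc f (c • 1 + x • S + y • T)).PosDef)
    (hdet : logDet (cfc f (c • 1 + x • S + y • T)) =
      t * logDet (mexp (a • S)) + (1 - t) * logDet (mexp (b • T)))
    (hle : cfc f (c • 1 + x • S + y • T) ≤ kuboAndo t (mexp (b • T)) (mexp (a • S))) :
    x = y * kuboSlope t a b := by
  have hS := h.left_mexp_posDef a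
  have hT := h.symm.left_mexp_posDef b
  exact h.eq_mul_kuboSlope_of_cfc_eq_kuboAndo hd ha hb ht <|
    eq_of_le_of_logDet_eq hpos (kuboAndo_posDef t hT hS) hle
      (hdet.trans (logDet_kuboAndo t hS hT).symm)

theorem sinh_eq_of_meanGTildeFun_le (h : IsPauliPair S T) (hd : 0 < d) (ha : 0 < a) (hb : 0 < b)
    (ht : t < 1) (hz : z ≠ 0)
    (hle : meanGTildeFun t z (mexp (a • S)) (mexp (b • T)) ≤
      kuboAndo t (mexp (b • T)) (mexp (a • S))) :
    Real.sinh (t / z * a) =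
      Real.cosh (t / z * a) * Real.sinh ((1 - t) / z * b) * kuboSlope t a b := by
  have hS := h.left_mexp_posDef a
  have hT := h.symm.left_mexp_posDef b
  have hinner : mpow (mexp (b • T)) ((1 - t) / (2 * z)) * mpow (mexp (a • S)) (t / z) *
      mpow (mexp (b • T)) ((1 - t) / (2 * z)) =
        (Real.cosh (t / z * a) * Real.cosh ((1 - t) / z * b)) • 1 + Real.sinh (t / z * a) • S +
          (Real.cosh (t / z * a) * Real.sinh ((1 - t) / z * b)) • T := by
    rw [mpow_mexp (h.right_isHermitian.smul (.all b)), mpow_mexp (h.left_isHermitian.smul (.all a)),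
      smul_smul, smul_smul, h.sandwich_mexp,
      show 2 * ((1 - t) / (2 * z) * b) = (1 - t) / z * b by field_simp]
  have hpos := sandwich_posDef (mpow_posDef hT ((1 - t) / (2 * z))) (mpow_posDef hS (t / z))
  have hdet := logDet_meanGTildeFun t hz hS hT
  have hposG := mpow_posDef hpos z
  rw [meanGTildeFun, hinner, mpow] at hle hdet
  rw [hinner, mpow] at hposG
  exact h.eq_mul_kuboSlope_of_cfc_le_kuboAndo hd ha hb ht hposG hdet hle

theorem kuboSlope_eq_of_meanGHatFun_le (h : IsPauliPair S T) (hd : 0 < d) (ha : 0 < a)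
    (hb : 0 < b) (ht : t < 1) (hz : 0 < z)
    (hle : meanGHatFun t z (mexp (a • S)) (mexp (b • T)) ≤
      kuboAndo t (mexp (b • T)) (mexp (a • S))) :
    kuboSlope t (1 / z * a) (1 / z * b) = kuboSlope t a b := by
  have hS := h.left_mexp_posDef a
  have hT := h.symm.left_mexp_posDef b
  have hz' := one_div_pos.2 hz
  obtain ⟨c, y, hy, hK⟩ := h.exists_kuboAndo_mexp_eq (mul_pos hz' ha) (mul_pos hz' hb) ht
  have hinner : kuboAndo t (mpow (mexp (b • T)) (1 / z)) (mpow (mexp (a • S)) (1 / z)) =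
      c • 1 + (y * kuboSlope t (1 / z * a) (1 / z * b)) • S + y • T := by
    rw [mpow_mexp (h.right_isHermitian.smul (.all b)), mpow_mexp (h.left_isHermitian.smul (.all a)),
      smul_smul, smul_smul, hK]
  have hposG := mpow_posDef (kuboAndo_posDef t (mpow_posDef hT (1 / z)) (mpow_posDef hS (1 / z))) z
  have hdet := logDet_meanGHatFun t hz.ne' hS hT
  rw [meanGHatFun, hinner, mpow] at hle hdet
  rw [hinner, mpow] at hposG
  exact mul_left_cancel₀ hy.ne'
    (h.eq_mul_kuboSlope_of_cfc_le_kuboAndo hd ha hb ht hposG hdet hle)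

theorem mul_eq_of_meanGHatTopFun_le (h : IsPauliPair S T) (hd : 0 < d) (ha : 0 < a) (hb : 0 < b)
    (ht : t < 1)
    (hle : meanGHatTopFun t (mexp (a • S)) (mexp (b • T)) ≤
      kuboAndo t (mexp (b • T)) (mexp (a • S))) :
    t * a = (1 - t) * b * kuboSlope t a b := by
  have hinner : t • mlog (mexp (a • S)) + (1 - t) • mlog (mexp (b • T)) =
      (0 : ℝ) • 1 + (t * a) • S + ((1 - t) * b) • T := by
    rw [mlog_mexp (h.left_isHermitian.smul (.all a)), mlog_mexp (h.right_isHermitian.smul (.all b)),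
      smul_smul, smul_smul, zero_smul, zero_add]
  have hposG := mexp_posDef (isHermitian_add_smul_mlog t (1 - t) (mexp (a • S)) (mexp (b • T)))
  have hdet := logDet_meanGHatTopFun t (h.left_mexp_posDef a) (h.symm.left_mexp_posDef b)
  rw [meanGHatTopFun, hinner, mexp] at hle hdet
  rw [hinner, mexp] at hposG
  exact h.eq_mul_kuboSlope_of_cfc_le_kuboAndo hd ha hb ht hposG hdet hle

end IsPauliPair

end PauliPairMeans

section KuboAndoBoundFails

open Asymptotics

variable {d : ℕ} {S T : Op d} {b t z : ℝ}

theorem meanGFun_eq_meanGTildeFun (t z : ℝ) (A₁ A₂ : Op d) :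
    meanGFun t z A₁ A₂ = meanGTildeFun (1 - t) z A₂ A₁ := by
  rw [meanGFun, meanGTildeFun, sub_sub_cancel]

namespace IsPauliPair

theorem exists_not_meanGTildeFun_le (h : IsPauliPair S T) (hd : 0 < d) (ht0 : 0 < t) (ht1 : t < 1)
    (hz : 0 < z) (hb : 0 < b) :
    ∃ a : ℝ, 0 < a ∧ ¬ meanGTildeFun t z (mexp (a • S)) (mexp (b • T)) ≤
      kuboAndo t (mexp (b • T)) (mexp (a • S)) := by
  by_contra! hle
  set κ := Real.sinh ((1 - t) / z * b) with hκdef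
  have hκ : 0 < κ := Real.sinh_pos_iff.2 (mul_pos (div_pos (sub_pos.2 ht1) hz) hb)
  refine not_kuboSlope_isBigO_of_isLittleO ht0 ht1 hb
    (isLittleO_pow_exp_pos_mul_atTop 0 (mul_pos two_pos ht0)) (IsBigO.of_bound κ⁻¹ ?_)
  filter_upwards [eventually_gt_atTop 0] with a ha
  have hslope := h.sinh_eq_of_meanGTildeFun_le hd ha hb ht1 hz.ne' (hle a ha)
  have := Real.cosh_pos (t / z * a)
  have htanh : kuboSlope t a b = κ⁻¹ * Real.tanh (t / z * a) := by
    rw [Real.tanh_eq_sinh_div_cosh, hslope, ← hκdef]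
    field_simp
  rw [htanh, norm_mul, pow_zero, norm_one, Real.norm_of_nonneg (inv_pos.2 hκ).le]
  gcongr
  exact (Real.abs_tanh_lt_one _).le

theorem exists_not_meanGFun_le (h : IsPauliPair S T) (hd : 0 < d) (ht0 : 0 < t) (ht1 : t < 1)
    (hz : 0 < z) (hb : 0 < b) :
    ∃ a : ℝ, 0 < a ∧ ¬ meanGFun t z (mexp (b • T)) (mexp (a • S)) ≤
      kuboAndo t (mexp (a • S)) (mexp (b • T)) := by
  obtain ⟨a, ha, hnot⟩ :=
    h.exists_not_meanGTildeFun_le hd (sub_pos.2 ht1) (sub_lt_self 1 ht0) hz hb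
  rw [h.kuboAndo_mexp_comm ha.ne' hb.ne', sub_sub_cancel, ← meanGFun_eq_meanGTildeFun] at hnot
  exact ⟨a, ha, hnot⟩

theorem exists_not_meanGHatFun_le (h : IsPauliPair S T) (hd : 0 < d) (ht0 : 0 < t) (ht1 : t < 1)
    (hz : 0 < z) (hz1 : z ≠ 1) (hb : 0 < b) :
    ∃ a : ℝ, 0 < a ∧ ¬ meanGHatFun t z (mexp (a • S)) (mexp (b • T)) ≤
      kuboAndo t (mexp (b • T)) (mexp (a • S)) := by
  by_contra! hle
  have hone : 1 / z = 1 := eq_one_of_forall_kuboSlope_mul_eq ht0 ht1 hb (one_div_pos.2 hz)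
    fun a ha => h.kuboSlope_eq_of_meanGHatFun_le hd ha hb ht1 hz (hle a ha)
  exact hz1 ((div_eq_one_iff_eq hz.ne').1 hone).symm

theorem exists_not_meanGHatTopFun_le (h : IsPauliPair S T) (hd : 0 < d) (ht0 : 0 < t) (ht1 : t < 1)
    (hb : 0 < b) :
    ∃ a : ℝ, 0 < a ∧ ¬ meanGHatTopFun t (mexp (a • S)) (mexp (b • T)) ≤
      kuboAndo t (mexp (b • T)) (mexp (a • S)) := by
  by_contra! hle
  have hlinear : (fun a => kuboSlope t a b) =ᶠ[atTop] fun a => t / ((1 - t) * b) * a ^ 1 := by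
    filter_upwards [eventually_gt_atTop 0] with a ha
    have hslope := h.mul_eq_of_meanGHatTopFun_le hd ha hb ht1 (hle a ha)
    have := sub_pos.2 ht1
    field_simp
    linarith
  exact not_kuboSlope_isBigO_of_isLittleO ht0 ht1 hb
    (isLittleO_pow_exp_pos_mul_atTop 1 (mul_pos two_pos ht0))
    (hlinear.trans_isBigO (isBigO_const_mul_self _ _ _))

end IsPauliPair

end KuboAndoBoundFails

theorem not_asympIndivAMBounded_ofFormula {t : ℝ} {F : ∀ d : ℕ, Op d → Op d → Op d} {hpos hconj}
    {d : ℕ} (hd : 0 < d)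
    (hhom : ∀ A₁ A₂ : Op d, A₁.PosDef → A₂.PosDef → ∀ c : ℝ, 0 < c →
      F d (c • A₁) A₂ = c ^ t • F d A₁ A₂)
    (hfail : ∃ A₁ A₂ : Op d, A₁.PosDef ∧ A₂.PosDef ∧ ¬ F d A₁ A₂ ≤ kuboAndo t A₂ A₁) :
    ¬ (ofFormula F hpos hconj).AsympIndivAMBounded := fun hF =>
  let ⟨A₁, A₂, h₁, h₂, hnot⟩ := hfail
  hnot (le_kuboAndo_of_asympIndivAMBounded t hF hd h₁ h₂ (hhom A₁ A₂ h₁ h₂))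

end OperatorMeans

open OperatorMeans in
theorem mainTheorem10_general (t : ℝ) (ht0 : 0 < t) (ht1 : t < 1) :
    ((∀ z : ℝ, 0 < z → ¬ (meanG t z).AsympIndivAMBounded) ∧
      (∀ z : ℝ, 0 < z → ¬ (meanGTilde t z).AsympIndivAMBounded) ∧
      (∀ z : ℝ, 0 < z → z ≠ 1 → ¬ (meanGHat t z).AsympIndivAMBounded) ∧
      ¬ (meanGHatTop t).AsympIndivAMBounded) ∧
    ((∀ z : ℝ, 0 < z → ∃ A₁ A₂ : Op 2, A₁.PosDef ∧ A₂.PosDef ∧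
        ¬ meanGFun t z A₁ A₂ ≤ kuboAndo t A₂ A₁) ∧
      (∀ z : ℝ, 0 < z → ∃ A₁ A₂ : Op 2, A₁.PosDef ∧ A₂.PosDef ∧
        ¬ meanGTildeFun t z A₁ A₂ ≤ kuboAndo t A₂ A₁) ∧
      (∀ z : ℝ, 0 < z → z ≠ 1 → ∃ A₁ A₂ : Op 2, A₁.PosDef ∧ A₂.PosDef ∧
        ¬ meanGHatFun t z A₁ A₂ ≤ kuboAndo t A₂ A₁) ∧
      ∃ A₁ A₂ : Op 2, A₁.PosDef ∧ A₂.PosDef ∧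
        ¬ meanGHatTopFun t A₁ A₂ ≤ kuboAndo t A₂ A₁) := by
  refine (and_iff_right_of_imp ?_).2 ?_
  · rintro ⟨hG, hGTilde, hGHat, hGHatTop⟩
    refine ⟨fun z hz => not_asympIndivAMBounded_ofFormula two_pos ?_ (hG z hz),
      fun z hz => not_asympIndivAMBounded_ofFormula two_pos ?_ (hGTilde z hz),
      fun z hz hz1 => not_asympIndivAMBounded_ofFormula two_pos ?_ (hGHat z hz hz1),
      not_asympIndivAMBounded_ofFormula two_pos ?_ hGHatTop⟩
    · exact fun _ _ h₁ h₂ _ => meanGFun_smul h₁ h₂ hz.ne'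
    · exact fun _ _ h₁ h₂ _ => meanGTildeFun_smul h₁ h₂ hz.ne'
    · exact fun _ _ h₁ h₂ _ => meanGHatFun_smul h₁ h₂ hz.ne'
    · exact fun _ _ h₁ _ _ => meanGHatTopFun_smul h₁
  · have hpair := isPauliPair_sigmaZ_sigmaX
    have hZ := hpair.left_mexp_posDef
    have hX := hpair.symm.left_mexp_posDef 1
    refine ⟨fun z hz => ?_, fun z hz => ?_, fun z hz hz1 => ?_, ?_⟩
    · obtain ⟨a, -, hnot⟩ := hpair.exists_not_meanGFun_le two_pos ht0 ht1 hz one_pos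
      exact ⟨_, _, hX, hZ a, hnot⟩
    · obtain ⟨a, -, hnot⟩ := hpair.exists_not_meanGTildeFun_le two_pos ht0 ht1 hz one_pos
      exact ⟨_, _, hZ a, hX, hnot⟩
    · obtain ⟨a, -, hnot⟩ := hpair.exists_not_meanGHatFun_le two_pos ht0 ht1 hz hz1 one_pos
      exact ⟨_, _, hZ a, hX, hnot⟩
    · obtain ⟨a, -, hnot⟩ := hpair.exists_not_meanGHatTopFun_le two_pos ht0 ht1 one_pos
      exact ⟨_, _, hZ a, hX, hnot⟩

theorem mainTheorem10 (t : ℝ) (ht0 : 0 < t) (ht1 : t < 1) :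
    -- none of the means is asymptotically individually AM bounded
    ((∀ z : ℝ, 0 < z → ¬ (OperatorMeans.meanG t z).AsympIndivAMBounded) ∧
      (∀ z : ℝ, 0 < z → ¬ (OperatorMeans.meanGTilde t z).AsympIndivAMBounded) ∧
      (∀ z : ℝ, 0 < z → z ≠ 1 → ¬ (OperatorMeans.meanGHat t z).AsympIndivAMBounded) ∧
      ¬ (OperatorMeans.meanGHatTop t).AsympIndivAMBounded) ∧
    -- 2×2 positive definite pairs at which the Kubo-Ando upper bound fails
    ((∀ z : ℝ, 0 < z → ∃ A₁ A₂ : OperatorMeans.Op 2, A₁.PosDef ∧ A₂.PosDef ∧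
        ¬ OperatorMeans.meanGFun t z A₁ A₂ ≤ OperatorMeans.kuboAndo t A₂ A₁) ∧
      (∀ z : ℝ, 0 < z → ∃ A₁ A₂ : OperatorMeans.Op 2, A₁.PosDef ∧ A₂.PosDef ∧
        ¬ OperatorMeans.meanGTildeFun t z A₁ A₂ ≤ OperatorMeans.kuboAndo t A₂ A₁) ∧
      (∀ z : ℝ, 1 < z → ∃ A₁ A₂ : OperatorMeans.Op 2, A₁.PosDef ∧ A₂.PosDef ∧
        ¬ OperatorMeans.meanGHatFun t z A₁ A₂ ≤ OperatorMeans.kuboAndo t A₂ A₁) ∧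
      ∃ A₁ A₂ : OperatorMeans.Op 2, A₁.PosDef ∧ A₂.PosDef ∧
        ¬ OperatorMeans.meanGHatTopFun t A₁ A₂ ≤ OperatorMeans.kuboAndo t A₂ A₁) :=
  (mainTheorem10_general t ht0 ht1).imp_right fun ⟨hG, hGTilde, hGHat, hGHatTop⟩ =>
    ⟨hG, hGTilde, fun z hz => hGHat z (one_pos.trans hz) hz.ne', hGHatTop⟩
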